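/- Let $\kappa$ be an uncountable regular cardinal with $\kappa^{<\kappa}=\kappa$ and let $\lambda<\kappa$ be an (infinite) regular cardinal. Conventions. The space $2^\kappa$ of all functions $\kappa\to\{0,1\}$ carries the topology generated by the sets $N_p=\{\eta: \eta\restriction\alpha=p\}$, $\alpha<\kappa$, $p\in 2^\alpha$. Borel sets (of $2^\kappa$ and of $2^\kappa\times 2^\kappa$) are obtained from open sets by complements and by unions and intersections of length $\le\kappa$; a function is Borel if inverse images of open sets are Borel. Let $\mathcal E_\kappa^B$ be the set of equivalence relations on $2^\kappa$ that are Borel subsets of $2^\kappa\times 2^\kappa$. Write $E\le_B E'$ if there is a Borel $f:2^\kappa\to 2^\kappa$ with $\eta\,E\,\xi\iff f(\eta)\,E'\,f(\xi)$ for all $\eta,\xi$, and $E\prec_B E'$ if $E\le_B E'$ and $E'\not\le_B E$. Let $\mathrm{id}$ be the identity relation on $2^\kappa$ and $E_0$ the relation "$\{\alpha:\eta(\alpha)\ne\xi(\alpha)\}$ is bounded in $\kappa$". A set $C\subseteq\kappa$ is $\lambda$-cub if it is unbounded and contains the suprema of its increasing sequences of length $\lambda$; a set is $\lambda$-stationary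 if it meets every $\lambda$-cub set; $X\subset_{\mathrm{NS}(\lambda)}Y$ means that $X\setminus Y$ is not $\lambda$-stationary. In the game $GC_\lambda(A)$, $A\subseteq\kappa$, of $\lambda$ moves, at move $i$ player I picks an ordinal $\alpha_i<\kappa$ greater than all ordinals picked before and II picks $\beta_i$ with $\alpha_i<\beta_i<\kappa$; II wins iff $\sup_{i<\lambda}\alpha_i\in A$. The $GC_\lambda$-characterization holds for $\kappa$ if, for all $A\subseteq\kappa$, II has a winning strategy in $GC_\lambda(A)$ if and only if $A$ contains a $\lambda$-cub set. Let $S^\kappa_\lambda$ be the set of ordinals below $\kappa$ of cofinality $\lambda$. For a set $S$ of limit ordinals below $\kappa$, $E_S$ is the relation on $2^\kappa$ such that $\eta\,E_S\,\xi$ iff $\eta\,E_0\,\xi$ and for every $\alpha\in S$ there is $\beta<\alpha$ such that $\eta\triangle\xi$ is constant on $(\beta,\alpha)$. For relations $E,E'$ on $2^\kappa$, $E\otimes E'$ is the product relation on $2^\kappa\times 2^\kappa$, which is identified with $2^\kappa$ by means of the bijection $(\beta,i)\mapsto 2\cdot\beta+i$ of $\kappa\times 2$ onto $\kappa$. Theorem.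 Assume that the $GC_\lambda$-characterization holds for $\kappa$. Then: (1) There is a one-to-one map $F:\mathcal P(\kappa)\to\mathcal E_\kappa^B$ such that for all $X,Y\in\mathcal P(\kappa)$ we have $\mathrm{id}\prec_B F(X)\prec_B E_0$ and $$X\subset_{\mathrm{NS}(\lambda)}Y\iff F(X)\le_B F(Y).$$ (2) Moreover, put $G(X)=\mathrm{id}\otimes E_{S^\kappa_\lambda\setminus X}$ for $X\subseteq\kappa$. Then $G$ maps $\mathcal P(\kappa)$ into $\mathcal E_\kappa^B$, it is one-to-one on $\mathcal P(S^\kappa_\lambda)$, and for all $X,Y\in\mathcal P(\kappa)$: $X\subset_{\mathrm{NS}(\lambda)}Y\iff G(X)\le_B G(Y)$; $\mathrm{id}\prec_B G(X)\le_B E_0$; and $G(X)\prec_B E_0$ if and only if $S^\kappa_\lambda\setminus X$ is $\lambda$-stationary. -/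

import Mathlib

open Set

universe u

/-- The ordinals below the (initial ordinal of the) cardinal `κ`, i.e. the set `κ` itself. -/
abbrev Below (κ : Cardinal.{u}) : Type (u + 1) := Set.Iio κ.ord

/-- The generalized Cantor space `2^κ`. -/
def Cantor (κ : Cardinal.{u}) : Type (u + 1) := Below κ → Bool

/-- The basic open set `N_p` of those `η ∈ 2^κ` that extend `p ∈ 2^α`, where `α < κ`. -/
def basicOpen (κ : Cardinal.{u}) (α : Below κ) (p : Set.Iio α → Bool) : Set (Cantor κ) :=
  {η | ∀ β : Set.Iio α, η β.1 = p β}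

/-- The bounded topology on `2^κ`: it is generated by the sets `N_p`. -/
instance (κ : Cardinal.{u}) : TopologicalSpace (Cantor κ) :=
  TopologicalSpace.generateFrom {U | ∃ (α : Below κ) (p : Set.Iio α → Bool), U = basicOpen κ α p}

/-- The Borel sets of generalized descriptive set theory: the closure of the open sets under
complements and under unions and intersections of length at most `κ`. -/
inductive IsBorelSet (κ : Cardinal.{u}) {Z : Type (u + 1)} [TopologicalSpace Z] : Set Z → Prop
  | of_isOpen (U : Set Z) (hU : IsOpen U) : IsBorelSet κ U
  | compl (A : Set Z) (hA : IsBorelSet κ A) : IsBorelSet κ Aᶜ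
  | iUnion (A : Below κ → Set Z) (hA : ∀ i, IsBorelSet κ (A i)) : IsBorelSet κ (⋃ i, A i)
  | iInter (A : Below κ → Set Z) (hA : ∀ i, IsBorelSet κ (A i)) : IsBorelSet κ (⋂ i, A i)

/-- Borel functions `2^κ → 2^κ`: inverse images of open sets are Borel. -/
def IsBorelFun (κ : Cardinal.{u}) (f : Cantor κ → Cantor κ) : Prop :=
  ∀ U : Set (Cantor κ), IsOpen U → IsBorelSet κ (f ⁻¹' U)

/-- Membership in the set of Borel equivalence relations on `2^κ`: the relation is an equivalence
relation, and it is a Borel subset of `(2^κ)²`. -/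
def IsBorelEquiv (κ : Cardinal.{u}) (R : Cantor κ → Cantor κ → Prop) : Prop :=
  Equivalence R ∧ IsBorelSet κ {p : Cantor κ × Cantor κ | R p.1 p.2}

/-- Borel reducibility `R ≤_B R'`. -/
def BorelReducible (κ : Cardinal.{u}) (R R' : Cantor κ → Cantor κ → Prop) : Prop :=
  ∃ f : Cantor κ → Cantor κ, IsBorelFun κ f ∧ ∀ η ξ, R η ξ ↔ R' (f η) (f ξ)

/-- Strict Borel reducibility: `R ≤_B R'` but not `R' ≤_B R`. -/
def StrictBorelReducible (κ : Cardinal.{u}) (R R' : Cantor κ → Cantor κ → Prop) : Prop :=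
  BorelReducible κ R R' ∧ ¬ BorelReducible κ R' R

/-- The identity relation on `2^κ`. -/
def idRel (κ : Cardinal.{u}) (η ξ : Cantor κ) : Prop := η = ξ

/-- The relation `E₀`: equality modulo a bounded subset of `κ`. -/
def E0 (κ : Cardinal.{u}) (η ξ : Cantor κ) : Prop := BddAbove {α : Below κ | η α ≠ ξ α}

/-- The relation `E_S^*`: for every `α ∈ S` the function `η △ ξ` is constant on some interval
`(β, α)` with `β < α`. -/
def EStar (κ : Cardinal.{u}) (S : Set (Below κ)) (η ξ : Cantor κ) : Prop :=
  ∀ α ∈ S, ∃ β < α, ∃ k : Bool, ∀ γ, β < γ → γ < α → (xor (η γ) (ξ γ)) = k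

/-- The relation `E_S = E_S^* ∩ E₀`. -/
def ES (κ : Cardinal.{u}) (S : Set (Below κ)) (η ξ : Cantor κ) : Prop :=
  EStar κ S η ξ ∧ E0 κ η ξ

theorem two_mul_add_lt_ord {κ : Cardinal.{u}} (hκ : Cardinal.aleph0 ≤ κ) (β : Below κ) :
    2 * β.1 < κ.ord ∧ 2 * β.1 + 1 < κ.ord := by
  have h2 : (2 : Ordinal.{u}) < κ.ord := by
    have := Cardinal.ord_le_ord.2 hκ
    rw [Cardinal.ord_aleph0] at this
    exact lt_of_lt_of_le (by exact_mod_cast Ordinal.natCast_lt_omega0 2) this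
  have h1 : 2 * β.1 < κ.ord := Ordinal.isPrincipal_mul_ord hκ h2 β.2
  exact ⟨h1, by simpa using (Cardinal.isSuccLimit_ord hκ).succ_lt h1⟩

/-- The even half `β ↦ η (2·β)` of `η`. Every ordinal is `2·β` or `2·β + 1` for exactly one `β`,
and `η ↦ (evenPart η, oddPart η)` is the identification of `2^κ` with `2^κ × 2^κ`, that is, with
`2^(κ × 2)`, that is used for products of relations. -/
def evenPart {κ : Cardinal.{u}} (hκ : Cardinal.aleph0 ≤ κ) (η : Cantor κ) : Cantor κ :=
  fun β => η ⟨2 * β.1, (two_mul_add_lt_ord hκ β).1⟩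

/-- The odd half `β ↦ η (2·β + 1)` of `η`. -/
def oddPart {κ : Cardinal.{u}} (hκ : Cardinal.aleph0 ≤ κ) (η : Cantor κ) : Cantor κ :=
  fun β => η ⟨2 * β.1 + 1, (two_mul_add_lt_ord hκ β).2⟩

/-- The product `R ⊗ R'` of two relations on `2^κ`, as a relation on `2^κ ≅ 2^κ × 2^κ`. -/
def tensor {κ : Cardinal.{u}} (hκ : Cardinal.aleph0 ≤ κ) (R R' : Cantor κ → Cantor κ → Prop)
    (η ξ : Cantor κ) : Prop :=
  R (evenPart hκ η) (evenPart hκ ξ) ∧ R' (oddPart hκ η) (oddPart hκ ξ)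

/-- The set `S^κ_μ` of the ordinals below `κ` of cofinality `μ`. -/
def cofSet (κ μ : Cardinal.{u}) : Set (Below κ) := {α | α.1.cof = μ}

/-- `C ⊆ κ` is `μ`-closed: it contains the suprema of its increasing sequences of length `μ`. -/
def IsSeqClosedOf (κ μ : Cardinal.{u}) (C : Set (Below κ)) : Prop :=
  ∀ s : Below μ → Below κ, StrictMono s → (∀ i, s i ∈ C) → ∀ γ, IsLUB (Set.range s) γ → γ ∈ C

/-- `μ`-cub sets: `μ`-closed and unbounded in `κ`. -/
def IsCubOf (κ μ : Cardinal.{u}) (C : Set (Below κ)) : Prop :=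
  IsSeqClosedOf κ μ C ∧ ∀ β : Below κ, ∃ γ ∈ C, β < γ

/-- `μ`-stationary sets: those that meet every `μ`-cub set. -/
def IsStationaryOf (κ μ : Cardinal.{u}) (A : Set (Below κ)) : Prop :=
  ∀ C, IsCubOf κ μ C → (A ∩ C).Nonempty

/-- Inclusion modulo the ideal of the sets that are not `μ`-stationary. -/
def SubsetNS (κ μ : Cardinal.{u}) (X Y : Set (Below κ)) : Prop := ¬ IsStationaryOf κ μ (X \ Y)

/-- A strategy of player II in the cub-game of length `μ`: it answers the moves `α_j`, `j ≤ i`, of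
player I by a move `β_i`. -/
abbrev Strategy (κ μ : Cardinal.{u}) : Type (u + 1) :=
  (i : Below μ) → (Set.Iic i → Below κ) → Below κ

/-- The `i`-th move `β_i` of player II, if player I plays `a` and player II follows `σ`. -/
def Strategy.reply {κ μ : Cardinal.{u}} (σ : Strategy κ μ) (a : Below μ → Below κ)
    (i : Below μ) : Below κ :=
  σ i (fun j => a j.1)

/-- `σ` is a winning strategy of player II in `GC_μ(A)`: whenever player I plays by the rules
against `σ` (his `i`-th move `α_i` exceeds all the moves `α_j` and `β_j` with `j < i`), all moves of
player II are legal (`β_i > α_i`) and the supremum of the `α_i` is in `A`. -/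
def Strategy.IsWinning {κ μ : Cardinal.{u}} (σ : Strategy κ μ) (A : Set (Below κ)) : Prop :=
  ∀ a : Below μ → Below κ, (∀ i, ∀ j < i, a j < a i ∧ σ.reply a j < a i) →
    (∀ i, a i < σ.reply a i) ∧ ∃ γ ∈ A, IsLUB (Set.range a) γ

/-- `GC_μ`-characterization holds for `κ`: player II has a winning strategy in `GC_μ(A)` exactly for
those `A ⊆ κ` that contain a `μ`-cub set. -/
def GCCharacterization (κ μ : Cardinal.{u}) : Prop :=
  {A : Set (Below κ) | ∃ σ : Strategy κ μ, σ.IsWinning A} =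
    {A : Set (Below κ) | ∃ C, IsCubOf κ μ C ∧ C ⊆ A}

/-- The relation `id ⊗ E_S`, where `S = S^κ_μ \ X`. -/
def GRel {κ : Cardinal.{u}} (hκ : Cardinal.aleph0 ≤ κ) (μ : Cardinal.{u}) (X : Set (Below κ)) :
    Cantor κ → Cantor κ → Prop :=
  tensor hκ (idRel κ) (ES κ (cofSet κ μ \ X))

-- Call a relation smooth if it reduces continuously to the identity. Each relation `GRel X`, and
-- each `FRel X` used for part (1), is a smooth relation intersected with `E0` of the odd halves
-- (`tensor_inter_E0_iff`). The smooth part says that the difference `η △ ξ` of the odd halves is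
-- eventually constant at the points of `S^κ_μ \ X`. `FRel` also requires this difference to be
-- scattered, and adds equality on `X` as a smooth factor so that the relation determines `X`. Since
-- `E0 ⊗ E0` is `E0` and the identity reduces to `E0`, all these relations reduce to `E0`.
--
-- Reductions. If `X \ Y` misses a `μ`-cub set `C`, let `n γ` be the next point of `C` after `γ`,
-- and send `η` to `η ∘ n`. At a limit of `C` eventual constancy is inherited, and below any other
-- point of cofinality `μ` the map `n` is eventually constant (`eventuallyConstBelow_comp_next`).
-- The smooth part of the source is stored in the identity factor of the target. On related pairs
-- the difference is then constant from some point on, by stationarity of `S^κ_μ \ X` or by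
-- scatteredness, so `E0` can be read off along `C`. If `S^κ_μ \ X` is not stationary, `GRel X` is
-- handled through `E0` instead (`E0_reducible_ES`).
--
-- Non-reductions. A Borel reduction is continuous on a comeager set `D`. Closedness of the smooth
-- target part makes it hold between the images of any two members of `D` whose difference is merely
-- locally admissible. So two segments can be continued with difference 0, forcing a 0 in the
-- difference of the images, and then with difference 1, forcing a 1, because the sources are no
-- longer `E0`-equivalent (`exists_alternation`). Iterated `μ` times, this makes the image
-- difference oscillate at a limit `δ` while the source difference is bad at most at `δ`
-- (`exists_run`). With the lengths interleaved with player I's moves this is a winning strategy for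
-- the complement of a set `A` at which only the target is restrictive, so that complement contains
-- a `μ`-cub set, and `A` is not stationary (`not_reducible_of_stationary`). A run of length `μ · μ`
-- oscillates at a cofinal set of points below a point of cofinality `μ`. This contradicts
-- scatteredness, so `E0` never reduces to `FRel X` (`E0_not_reducible_of_scattered`).

universe v

/-! ### Cardinality and cofinality below `κ`. -/

section Order

variable {κ μ : Cardinal.{u}}

theorem lift_cof_le_of_cofinal {a : Ordinal.{u}} {U : Set Ordinal.{u}} (hU : ∀ x ∈ U, x < a)
    (h : ∀ b < a, ∃ x ∈ U, b ≤ x) : Cardinal.lift.{u + 1} a.cof ≤ Cardinal.mk U := by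
  have h1 : IsCofinal {x : Set.Iio a | x.1 ∈ U} := fun b => by
    obtain ⟨x, hx, hb⟩ := h b.1 b.2
    exact ⟨⟨x, hU x hx⟩, hx, hb⟩
  have h2 := Order.cof_le h1
  rw [Ordinal.cof_Iio, ← Ordinal.lift_cof] at h2
  refine h2.trans (Cardinal.mk_le_of_injective (f := fun x => ⟨x.1.1, x.2⟩) ?_)
  intro x y hxy
  exact Subtype.ext (Subtype.ext (by simpa using hxy))

theorem lift_cof_le_mk {α : Below κ} {U : Set (Below κ)} (hU : ∀ x ∈ U, x < α)
    (h : ∀ b < α, ∃ x ∈ U, b ≤ x) : Cardinal.lift.{u + 1} α.1.cof ≤ Cardinal.mk U := by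
  refine (lift_cof_le_of_cofinal (a := α.1) (U := Subtype.val '' U) ?_ ?_).trans
    Cardinal.mk_image_le
  · rintro _ ⟨x, hx, rfl⟩
    exact hU x hx
  · intro b hb
    obtain ⟨x, hx, hbx⟩ := h ⟨b, hb.trans α.2⟩ hb
    exact ⟨x.1, ⟨x, hx, rfl⟩, hbx⟩

theorem mem_Iio_ord_of_lt {i : Below κ} {a : Ordinal.{u}} (h : a < i.1) : a ∈ Set.Iio κ.ord :=
  lt_trans h i.2

theorem mk_below (κ : Cardinal.{u}) : Cardinal.mk (Below κ) = Cardinal.lift.{u + 1} κ := by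
  rw [Below, Cardinal.mk_Iio_ordinal, Cardinal.card_ord]

theorem mk_Iio_below (i : Below κ) :
    Cardinal.mk (Set.Iio i) = Cardinal.lift.{u + 1} i.1.card := by
  rw [← Cardinal.mk_Iio_ordinal]
  refine Cardinal.mk_congr ⟨fun x => ⟨x.1.1, x.2⟩, fun x => ⟨⟨x.1, mem_Iio_ord_of_lt x.2⟩, x.2⟩,
    fun x => rfl, fun x => rfl⟩

theorem mk_Iio_below_lt (i : Below κ) : Cardinal.mk (Set.Iio i) < Cardinal.lift.{u + 1} κ := by
  rw [mk_Iio_below, Cardinal.lift_lt]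
  exact Cardinal.lt_ord.1 i.2

theorem exists_forall_lt (hκ : κ.IsRegular) {ι : Type (u + 1)} (f : ι → Below κ)
    (hι : Cardinal.mk ι < Cardinal.lift.{u + 1} κ) : ∃ b, ∀ i, f i < b := by
  by_contra! hcon
  have := lift_cof_le_of_cofinal (a := κ.ord) (U := Set.range fun i => (f i).1)
    (by rintro _ ⟨i, rfl⟩; exact (f i).2)
    (fun b hb => by
      obtain ⟨i, hi⟩ := hcon ⟨b, hb⟩
      exact ⟨_, ⟨i, rfl⟩, hi⟩)
  rw [hκ.cof_ord] at this
  exact absurd (this.trans Cardinal.mk_range_le) hι.not_ge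

theorem exists_forall_lt_Iio (hκ : κ.IsRegular) {i : Below κ} (f : Set.Iio i → Below κ) :
    ∃ b, ∀ j, f j < b :=
  exists_forall_lt hκ f (mk_Iio_below_lt i)

theorem bddAbove_of_mk_lt (hκ : κ.IsRegular) {U : Set (Below κ)}
    (hU : Cardinal.mk U < Cardinal.lift.{u + 1} κ) : BddAbove U := by
  obtain ⟨b, hb⟩ := exists_forall_lt hκ (fun x : U => x.1) hU
  exact ⟨b, fun x hx => (hb ⟨x, hx⟩).le⟩

theorem mk_lt_of_bddAbove (hκ : κ.IsRegular) {U : Set (Below κ)} (hU : BddAbove U) :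
    Cardinal.mk U < Cardinal.lift.{u + 1} κ := by
  obtain ⟨b, hb⟩ := hU
  obtain ⟨c, hc⟩ : ∃ c, b < c := by
    refine ⟨⟨Order.succ b.1, (Cardinal.isSuccLimit_ord hκ.aleph0_le).succ_lt b.2⟩, ?_⟩
    exact Order.lt_succ b.1
  exact (Cardinal.mk_le_mk_of_subset fun x hx => (hb hx).trans_lt hc).trans_lt (mk_Iio_below_lt c)

theorem exists_gt_below (hκ : κ.IsRegular) (b : Below κ) : ∃ c, b < c :=
  ⟨⟨Order.succ b.1, (Cardinal.isSuccLimit_ord hκ.aleph0_le).succ_lt b.2⟩, Order.lt_succ b.1⟩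

theorem nonempty_below (hκ : κ.IsRegular) : Nonempty (Below κ) := ⟨⟨0, hκ.ord_pos⟩⟩

theorem exists_isLUB_of_bddAbove {U : Set (Below κ)} (hU : BddAbove U) : ∃ a, IsLUB U a :=
  ⟨WellFounded.min wellFounded_lt (upperBounds U) hU, WellFounded.min_mem _ _ _,
    fun _ hb => WellFounded.min_le _ hb⟩

theorem isSuccLimit_of_mem_cofSet (hμ : μ.IsRegular) {α : Below κ} (hα : α ∈ cofSet κ μ) :
    Order.IsSuccLimit α.1 := by
  rw [← Ordinal.one_lt_cof_iff, show α.1.cof = μ from hα]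
  exact Cardinal.one_lt_aleph0.trans_le hμ.aleph0_le

theorem exists_between_of_mem_cofSet (hμ : μ.IsRegular) {α β : Below κ} (hα : α ∈ cofSet κ μ)
    (h : β < α) : ∃ γ, β < γ ∧ γ < α :=
  ⟨⟨Order.succ β.1, ((isSuccLimit_of_mem_cofSet hμ hα).succ_lt h).trans α.2⟩, Order.lt_succ β.1,
    (isSuccLimit_of_mem_cofSet hμ hα).succ_lt h⟩

theorem exists_lt_of_mem_cofSet (hμ : μ.IsRegular) {α : Below κ} (hα : α ∈ cofSet κ μ) :
    ∃ β, β < α :=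
  ⟨⟨0, ((isSuccLimit_of_mem_cofSet hμ hα).bot_lt).trans α.2⟩,
    (isSuccLimit_of_mem_cofSet hμ hα).bot_lt⟩

/-- The map `s` embeds `ι` cofinally into `α`, and cofinality is invariant under strictly monotone
cofinal maps. No continuity of `s` is needed. -/
theorem mem_cofSet_of_isLUB {α ι : Below κ} {s : Below κ → Below κ} (hs : StrictMono s)
    (hμ : μ.IsRegular) (hι : ι ∈ cofSet κ μ) (h : IsLUB (s '' Set.Iio ι) α) :
    α ∈ cofSet κ μ := by
  have hlt : ∀ i < ι, s i < α := fun i hi => by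
    obtain ⟨j, hij, hj⟩ := exists_between_of_mem_cofSet hμ hι hi
    exact (hs hij).trans_le (h.1 ⟨j, hj, rfl⟩)
  let g : Set.Iio ι.1 → Set.Iio α.1 := fun i =>
    ⟨(s ⟨i.1, mem_Iio_ord_of_lt i.2⟩).1, hlt ⟨i.1, mem_Iio_ord_of_lt i.2⟩ i.2⟩
  have hg : StrictMono g := fun i j hij => hs (a := ⟨i.1, _⟩) (b := ⟨j.1, _⟩) hij
  have hg' : IsCofinal (Set.range g) := fun b => by
    obtain ⟨_, ⟨i, hi, rfl⟩, hbi⟩ := (lt_isLUB_iff h).1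
      (show (⟨b.1, mem_Iio_ord_of_lt b.2⟩ : Below κ) < α from b.2)
    exact ⟨g ⟨i.1, hi⟩, ⟨_, rfl⟩, hbi.le⟩
  have := Order.cof_congr_of_strictMono hg hg'
  rw [Ordinal.cof_Iio, Ordinal.cof_Iio, ← Ordinal.lift_cof, ← Ordinal.lift_cof,
    Cardinal.lift_inj] at this
  exact this.symm.trans hι

theorem exists_cofinal_of_mem_cofSet {α : Below κ} (hα : α ∈ cofSet κ μ) :
    ∃ g : Below μ → Below κ, (∀ i, g i < α) ∧ ∀ β < α, ∃ i, β ≤ g i := by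
  obtain ⟨s, hs, hc⟩ := Order.exists_cof_eq (Set.Iio α.1)
  rw [Ordinal.cof_Iio, ← Ordinal.lift_cof, show α.1.cof = μ from hα, ← mk_below] at hc
  obtain ⟨e⟩ := Cardinal.eq.1 hc
  refine ⟨fun i => ⟨(e.symm i).1.1, mem_Iio_ord_of_lt (e.symm i).1.2⟩, fun i => (e.symm i).1.2, ?_⟩
  intro β hβ
  obtain ⟨x, hx, hβx⟩ := hs ⟨β.1, hβ⟩
  refine ⟨e ⟨x, hx⟩, ?_⟩
  simp only [Equiv.symm_apply_apply]
  exact hβx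

theorem exists_lt_forall_lt_of_mem_cofSet {α : Below κ} (hα : α ∈ cofSet κ μ)
    {i : Below μ} (f : Set.Iio i → Below κ) (hf : ∀ j, f j < α) :
    ∃ b < α, ∀ j, f j < b := by
  by_contra! hcon
  have := lift_cof_le_mk (α := α) (U := Set.range f) (by rintro _ ⟨j, rfl⟩; exact hf j)
    (fun b hb => by
      obtain ⟨j, hj⟩ := hcon b hb
      exact ⟨_, ⟨j, rfl⟩, hj⟩)
  rw [show α.1.cof = μ from hα] at this
  exact absurd (this.trans Cardinal.mk_range_le) (mk_Iio_below_lt i).not_ge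

/-- A set that is unbounded below a point of cofinality `μ` contains an increasing sequence of
length `μ` that converges to this point. -/
theorem exists_strictMono_isLUB {α : Below κ} (hα : α ∈ cofSet κ μ)
    {U : Set (Below κ)} (hU : ∀ β < α, ∃ u ∈ U, β < u ∧ u < α) :
    ∃ s : Below μ → Below κ, StrictMono s ∧ (∀ i, s i ∈ U) ∧ (∀ i, s i < α) ∧
      IsLUB (Set.range s) α := by
  classical
  obtain ⟨g, hg, hgc⟩ := exists_cofinal_of_mem_cofSet hα
  have key : ∀ (i : Below μ) (p : (j : Below μ) → j < i → {x : Below κ // x ∈ U ∧ x < α}),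
      ∃ x : {x : Below κ // x ∈ U ∧ x < α}, g i < x.1 ∧ ∀ j h, (p j h).1 < x.1 := by
    intro i p
    obtain ⟨b, hb, hlt⟩ := exists_lt_forall_lt_of_mem_cofSet hα
      (fun j : Set.Iio i => (p j.1 j.2).1) (fun j => (p j.1 j.2).2.2)
    obtain ⟨x, hx, h1, h2⟩ := hU (max b (g i)) (max_lt hb (hg i))
    exact ⟨⟨x, hx, h2⟩, (le_max_right _ _).trans_lt h1,
      fun j h => (hlt ⟨j, h⟩).trans ((le_max_left _ _).trans_lt h1)⟩
  choose F hF1 hF2 using key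
  let s : Below μ → {x : Below κ // x ∈ U ∧ x < α} :=
    (wellFounded_lt (α := Below μ)).fix F
  have hs : ∀ i, s i = F i fun j _ => s j := fun i => WellFounded.fix_eq _ _ _
  refine ⟨fun i => (s i).1, ?_, fun i => (s i).2.1, fun i => (s i).2.2, ?_, ?_⟩
  · intro j i hji
    show (s j).1 < (s i).1
    rw [hs i]
    exact hF2 i (fun j _ => s j) j hji
  · rintro _ ⟨i, rfl⟩
    exact (s i).2.2.le
  · intro b hb
    by_contra! hlt
    obtain ⟨i, hi⟩ := hgc b hlt
    have h1 : g i < (s i).1 := by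
      rw [hs i]
      exact hF1 i _
    exact absurd (hb ⟨i, rfl⟩) (hi.trans_lt h1).not_ge

end Order

/-! ### Transfinite constructions by extending initial segments. -/

section Chain

variable {κ μ : Cardinal.{u}} {Z : Type v}

/-- A stage of a construction of length `κ` of an element of `Z^κ`: a length, and an element of
`Z^κ` of which only the part below this length is fixed. -/
abbrev Stage (κ : Cardinal.{u}) (Z : Type v) : Type (max (u + 1) v) := Below κ × (Below κ → Z)

/-- The second stage extends the first one. -/
def Stage.Extends (c c' : Stage κ Z) : Prop := c.1 < c'.1 ∧ ∀ γ < c.1, c'.2 γ = c.2 γ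

open Classical in
/-- The union of the stages before `i`. -/
noncomputable def limitStage (c₀ : Stage κ Z) (i : Below κ) (p : Set.Iio i → Stage κ Z) :
    Stage κ Z :=
  -- For `i = 0` the supremum of the empty family is `0`, so the length of `c₀` is forgotten there;
  -- only its second component survives.
  (if h : ∃ b, IsLUB (Set.range fun j => (p j).1) b then h.choose else c₀.1,
    fun γ => if h : ∃ j, γ < (p j).1 then (p h.choose).2 γ else c₀.2 γ)

/-- The sequence of stages given by the extension functions `ext i`. -/
noncomputable def runStage (c₀ : Stage κ Z) (ext : Below κ → Stage κ Z → Stage κ Z) :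
    Below κ → Stage κ Z :=
  (wellFounded_lt (α := Below κ)).fix fun i p => ext i (limitStage c₀ i fun j => p j.1 j.2)

/-- The union of the stages before `i` in a sequence of stages. -/
noncomputable def preStage (c₀ : Stage κ Z) (ext : Below κ → Stage κ Z → Stage κ Z)
    (i : Below κ) : Stage κ Z :=
  limitStage c₀ i fun j => runStage c₀ ext j.1

variable {c₀ : Stage κ Z} {ext : Below κ → Stage κ Z → Stage κ Z}

theorem runStage_eq (i : Below κ) : runStage c₀ ext i = ext i (preStage c₀ ext i) :=
  WellFounded.fix_eq _ _ _

/-- Causality: a stage sees only the extension functions up to its own index. This is what turns a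
run into a strategy in the cub-game. -/
theorem runStage_congr {ext' : Below κ → Stage κ Z → Stage κ Z} (i : Below κ)
    (h : ∀ j ≤ i, ext j = ext' j) : runStage c₀ ext i = runStage c₀ ext' i := by
  induction i using WellFoundedLT.induction with
  | ind i ih =>
    rw [runStage_eq, runStage_eq, h i le_rfl, preStage, preStage]
    congr 2
    funext j
    exact ih j.1 j.2 fun k hk => h k (hk.trans (le_of_lt j.2))

theorem isLUB_preStage (hκ : κ.IsRegular) (i : Below κ) :
    IsLUB ((fun j => (runStage c₀ ext j).1) '' Set.Iio i) (preStage c₀ ext i).1 := by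
  have h : ∃ b, IsLUB (Set.range fun j : Set.Iio i => (runStage c₀ ext j.1).1) b := by
    apply exists_isLUB_of_bddAbove
    obtain ⟨b, hb⟩ := exists_forall_lt_Iio hκ fun j : Set.Iio i => (runStage c₀ ext j.1).1
    exact ⟨b, by rintro _ ⟨j, rfl⟩; exact (hb j).le⟩
  have h2 : (preStage c₀ ext i).1 = h.choose := dif_pos h
  rw [h2, Set.image_eq_range]
  exact h.choose_spec

theorem preStage_snd {i γ : Below κ} (h : ∃ j < i, γ < (runStage c₀ ext j).1) :
    ∃ j < i, γ < (runStage c₀ ext j).1 ∧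
      (preStage c₀ ext i).2 γ = (runStage c₀ ext j).2 γ := by
  have h' : ∃ j : Set.Iio i, γ < (runStage c₀ ext j.1).1 := by
    obtain ⟨j, hj, hγ⟩ := h
    exact ⟨⟨j, hj⟩, hγ⟩
  exact ⟨h'.choose.1, h'.choose.2, h'.choose_spec, dif_pos h'⟩

theorem preStage_snd_of_forall_not_lt {i : Below κ} (h : ∀ j, ¬ j < i) :
    (preStage c₀ ext i).2 = c₀.2 := by
  funext γ
  exact dif_neg fun ⟨j, _⟩ => h j.1 j.2

theorem extends_runStage (hκ : κ.IsRegular) (hext : ∀ i c, Stage.Extends c (ext i c))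
    (i : Below κ) : ∀ j < i, Stage.Extends (runStage c₀ ext j) (runStage c₀ ext i) := by
  induction i using WellFoundedLT.induction with
  | ind i ih =>
    intro j hj
    have hlub := isLUB_preStage (c₀ := c₀) (ext := ext) hκ i
    have hle : (runStage c₀ ext j).1 ≤ (preStage c₀ ext i).1 := hlub.1 ⟨j, hj, rfl⟩
    have hx := hext i (preStage c₀ ext i)
    rw [← runStage_eq (c₀ := c₀) (ext := ext)] at hx
    refine ⟨hle.trans_lt hx.1, fun γ hγ => ?_⟩
    rw [hx.2 γ (hγ.trans_le hle)]
    obtain ⟨k, hk, hγk, he⟩ := preStage_snd (c₀ := c₀) (ext := ext) ⟨j, hj, hγ⟩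
    rw [he]
    rcases lt_trichotomy k j with h | h | h
    · exact ((ih j hj k h).2 γ hγk).symm
    · rw [h]
    · exact (ih k hk j h).2 γ hγ

theorem preStage_agree (hκ : κ.IsRegular) (hext : ∀ i c, Stage.Extends c (ext i c))
    {i j γ : Below κ} (hj : j < i) (hγ : γ < (runStage c₀ ext j).1) :
    (preStage c₀ ext i).2 γ = (runStage c₀ ext j).2 γ := by
  obtain ⟨k, hk, hγk, he⟩ := preStage_snd (c₀ := c₀) (ext := ext) ⟨j, hj, hγ⟩
  rw [he]
  rcases lt_trichotomy k j with h | h | h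
  · exact ((extends_runStage hκ hext j k h).2 γ hγk).symm
  · rw [h]
  · exact (extends_runStage hκ hext k j h).2 γ hγ

theorem strictMono_runStage (hκ : κ.IsRegular) (hext : ∀ i c, Stage.Extends c (ext i c)) :
    StrictMono fun i => (runStage c₀ ext i).1 :=
  fun j i h => (extends_runStage hκ hext i j h).1

/-- Points of cofinality `μ` that are closed under a given function are unbounded. -/
theorem exists_mem_cofSet_closed (hκ : κ.IsRegular) (hμ : μ.IsRegular) (hμκ : μ < κ)
    (g : Below κ → Below κ) (β : Below κ) :
    ∃ δ ∈ cofSet κ μ, β < δ ∧ ∀ γ < δ, g γ < δ := by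
  have key : ∀ c : Stage κ Unit, ∃ b, c.1 < b ∧ β < b ∧ ∀ γ < c.1, g γ < b := by
    intro c
    obtain ⟨b, hb⟩ := exists_forall_lt_Iio hκ fun j : Set.Iio c.1 => g j.1
    obtain ⟨b', hb'⟩ := exists_gt_below hκ (max (max c.1 β) b)
    refine ⟨b', (le_max_left _ _).trans_lt ((le_max_left _ _).trans_lt hb'),
      (le_max_right _ _).trans_lt ((le_max_left _ _).trans_lt hb'), fun γ hγ => ?_⟩
    exact (hb ⟨γ, hγ⟩).trans ((le_max_right _ _).trans_lt hb')
  choose F hF1 hF2 hF3 using key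
  let ext : Below κ → Stage κ Unit → Stage κ Unit := fun _ c => (F c, c.2)
  have hext : ∀ i c, Stage.Extends c (ext i c) := fun i c => ⟨hF1 c, fun _ _ => rfl⟩
  let c₀ : Stage κ Unit := (β, fun _ => ())
  -- The construction has length `κ`; its union up to stage `μ` is the required point.
  let ι : Below κ := ⟨μ.ord, Cardinal.ord_lt_ord.2 hμκ⟩
  have hι : ι ∈ cofSet κ μ := hμ.cof_ord
  have hlub := isLUB_preStage (c₀ := c₀) (ext := ext) hκ ι
  have hlt : ∀ j < ι, (runStage c₀ ext j).1 < (preStage c₀ ext ι).1 := fun j hj => by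
    obtain ⟨k, hjk, hk⟩ := exists_between_of_mem_cofSet hμ hι hj
    exact (strictMono_runStage hκ hext hjk).trans_le (hlub.1 ⟨k, hk, rfl⟩)
  refine ⟨(preStage c₀ ext ι).1, mem_cofSet_of_isLUB (strictMono_runStage hκ hext) hμ hι hlub,
    ?_, ?_⟩
  · obtain ⟨j, hj⟩ := exists_lt_of_mem_cofSet hμ hι
    refine lt_trans ?_ (hlt j hj)
    rw [runStage_eq]
    exact hF2 _
  · intro γ hγ
    obtain ⟨_, ⟨j, hj, rfl⟩, hγj⟩ := (lt_isLUB_iff hlub).1 hγ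
    obtain ⟨k, hjk, hk⟩ := exists_between_of_mem_cofSet hμ hι hj
    refine lt_trans ?_ (hlt k hk)
    rw [runStage_eq]
    refine hF3 _ γ (lt_of_lt_of_le hγj ?_)
    exact (isLUB_preStage hκ k).1 ⟨j, hjk, rfl⟩

end Chain

/-! ### The bounded topology and Borel sets. -/

section Topology

variable {κ : Cardinal.{u}}

theorem isOpen_setOf_agree (α : Below κ) (η : Cantor κ) :
    IsOpen {ξ : Cantor κ | ∀ γ < α, ξ γ = η γ} := by
  apply TopologicalSpace.isOpen_generateFrom_of_mem
  refine ⟨α, fun β => η β.1, ?_⟩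
  ext ξ
  exact ⟨fun h β => h β.1 β.2, fun h γ hγ => h ⟨γ, hγ⟩⟩

theorem isOpen_cantor_iff (hκ : κ.IsRegular) {U : Set (Cantor κ)} :
    IsOpen U ↔ ∀ η ∈ U, ∃ α, ∀ ξ : Cantor κ, (∀ γ < α, ξ γ = η γ) → ξ ∈ U := by
  constructor
  · intro h
    induction h with
    | basic s hs =>
      obtain ⟨α, p, rfl⟩ := hs
      intro η hη
      exact ⟨α, fun ξ h β => (h β.1 β.2).trans (hη β)⟩
    | univ =>
      obtain ⟨b⟩ := nonempty_below hκ
      exact fun η _ => ⟨b, fun _ _ => trivial⟩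
    | inter s t _ _ hs ht =>
      intro η hη
      obtain ⟨a, ha⟩ := hs η hη.1
      obtain ⟨b, hb⟩ := ht η hη.2
      exact ⟨max a b, fun ξ h => ⟨ha ξ fun γ hγ => h γ (lt_max_of_lt_left hγ),
        hb ξ fun γ hγ => h γ (lt_max_of_lt_right hγ)⟩⟩
    | sUnion S _ ih =>
      rintro η ⟨s, hs, hη⟩
      obtain ⟨a, ha⟩ := ih s hs η hη
      exact ⟨a, fun ξ h => ⟨s, hs, ha ξ h⟩⟩
  · intro h
    have := nonempty_below hκ
    choose! a ha using h
    have : U = ⋃ η : U, {ξ : Cantor κ | ∀ γ < a η.1, ξ γ = η.1 γ} := by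
      ext ξ
      simp only [mem_iUnion, mem_ofPred_eq]
      exact ⟨fun h => ⟨⟨ξ, h⟩, fun _ _ => rfl⟩, fun ⟨η, hη⟩ => ha η.1 η.2 ξ hη⟩
    rw [this]
    exact isOpen_iUnion fun η => isOpen_setOf_agree _ _

theorem isOpen_setOf_apply (hκ : κ.IsRegular) (γ : Below κ) (k : Bool) :
    IsOpen {η : Cantor κ | η γ = k} := by
  rw [isOpen_cantor_iff hκ]
  intro η hη
  obtain ⟨b, hb⟩ := exists_gt_below hκ γ
  exact ⟨b, fun ξ h => (h γ hb).trans hη⟩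

/-- If every value of `f` depends on a bounded part of the argument, then `f` is continuous. -/
theorem continuous_of_local (hκ : κ.IsRegular) {f : Cantor κ → Cantor κ}
    (h : ∀ γ, ∃ δ, ∀ η ξ : Cantor κ, (∀ β < δ, ξ β = η β) → f ξ γ = f η γ) : Continuous f := by
  refine ⟨fun U hU => ?_⟩
  rw [isOpen_cantor_iff hκ] at hU ⊢
  intro η hη
  obtain ⟨α, hα⟩ := hU (f η) hη
  choose g hg using h
  -- Regularity bounds the moduli of the fewer than `κ` coordinates below `α` simultaneously.
  obtain ⟨b, hb⟩ := exists_forall_lt_Iio hκ fun γ : Set.Iio α => g γ.1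
  exact ⟨b, fun ξ hξ => hα (f ξ) fun γ hγ => hg γ η ξ fun β hβ => hξ β (hβ.trans (hb ⟨γ, hγ⟩))⟩

theorem local_of_continuous (hκ : κ.IsRegular) {f : Cantor κ → Cantor κ} (hf : Continuous f)
    (η : Cantor κ) (α : Below κ) :
    ∃ δ, ∀ ξ : Cantor κ, (∀ β < δ, ξ β = η β) → ∀ γ < α, f ξ γ = f η γ := by
  have h := (isOpen_setOf_agree α (f η)).preimage hf
  rw [isOpen_cantor_iff hκ] at h
  exact h η fun _ _ => rfl

theorem IsBorelSet.preimage {Z Z' : Type (u + 1)} [TopologicalSpace Z] [TopologicalSpace Z']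
    {f : Z → Z'} (hf : ∀ U, IsOpen U → IsBorelSet κ (f ⁻¹' U)) {A : Set Z'}
    (hA : IsBorelSet κ A) : IsBorelSet κ (f ⁻¹' A) := by
  induction hA with
  | of_isOpen _ hU => exact hf _ hU
  | compl A _ ih => exact IsBorelSet.compl _ ih
  | iUnion A _ ih =>
    rw [preimage_iUnion]
    exact IsBorelSet.iUnion _ ih
  | iInter A _ ih =>
    rw [preimage_iInter]
    exact IsBorelSet.iInter _ ih

theorem IsBorelSet.of_isClosed {Z : Type (u + 1)} [TopologicalSpace Z] {A : Set Z}
    (hA : IsClosed A) : IsBorelSet κ A := by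
  rw [← compl_compl A]
  exact IsBorelSet.compl _ (IsBorelSet.of_isOpen _ hA.isOpen_compl)

theorem IsBorelSet.inter (hκ : κ.IsRegular) {Z : Type (u + 1)} [TopologicalSpace Z]
    {A B : Set Z} (hA : IsBorelSet κ A) (hB : IsBorelSet κ B) : IsBorelSet κ (A ∩ B) := by
  classical
  obtain ⟨b⟩ := nonempty_below hκ
  obtain ⟨c, hc⟩ := exists_gt_below hκ b
  have : A ∩ B = ⋂ i, if i = b then A else B := by
    ext x
    simp only [mem_inter_iff, mem_iInter]
    constructor
    · intro h i
      split_ifs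
      exacts [h.1, h.2]
    · intro h
      have h1 := h b
      have h2 := h c
      rw [if_pos rfl] at h1
      rw [if_neg hc.ne'] at h2
      exact ⟨h1, h2⟩
  rw [this]
  refine IsBorelSet.iInter _ fun i => ?_
  split_ifs
  exacts [hA, hB]

theorem IsBorelFun.of_continuous {f : Cantor κ → Cantor κ} (hf : Continuous f) :
    IsBorelFun κ f :=
  fun _ hU => IsBorelSet.of_isOpen _ (hU.preimage hf)

theorem IsBorelFun.comp {f g : Cantor κ → Cantor κ} (hg : IsBorelFun κ g)
    (hf : IsBorelFun κ f) : IsBorelFun κ (g ∘ f) :=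
  fun _ hU => IsBorelSet.preimage hf (hg _ hU)

theorem BorelReducible.trans {R R' R'' : Cantor κ → Cantor κ → Prop}
    (h : BorelReducible κ R R') (h' : BorelReducible κ R' R'') : BorelReducible κ R R'' := by
  obtain ⟨f, hf, hfR⟩ := h
  obtain ⟨g, hg, hgR⟩ := h'
  exact ⟨g ∘ f, hg.comp hf, fun η ξ => (hfR η ξ).trans (hgR _ _)⟩

end Topology

/-! ### Baire category in `2^κ`. -/

section Baire

variable {κ : Cardinal.{u}}

/-- `κ`-comeager sets: those that include an intersection of `κ` dense open sets. -/
def Comeager (A : Set (Cantor κ)) : Prop :=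
  ∃ D : Below κ → Set (Cantor κ), (∀ i, IsOpen (D i) ∧ Dense (D i)) ∧ ⋂ i, D i ⊆ A

theorem Comeager.mono {A B : Set (Cantor κ)} (hA : Comeager A) (h : A ⊆ B) : Comeager B := by
  obtain ⟨D, hD, hDA⟩ := hA
  exact ⟨D, hD, hDA.trans h⟩

theorem comeager_of_isOpen {A : Set (Cantor κ)} (hA : IsOpen A) (hd : Dense A)
    (hκ : κ.IsRegular) : Comeager A :=
  ⟨fun _ => A, fun _ => ⟨hA, hd⟩, iInter_subset _ (nonempty_below hκ).some⟩

theorem comeager_iInter (hκ : κ.IsRegular) {A : Below κ → Set (Cantor κ)}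
    (hA : ∀ i, Comeager (A i)) : Comeager (⋂ i, A i) := by
  choose D hD hDA using hA
  have hc : Cardinal.mk (Below κ × Below κ) = Cardinal.mk (Below κ) := by
    rw [Cardinal.mk_prod, Cardinal.lift_id, mk_below]
    exact Cardinal.mul_eq_self (by simpa using hκ.aleph0_le)
  obtain ⟨e⟩ := Cardinal.eq.1 hc
  refine ⟨fun i => D (e.symm i).1 (e.symm i).2, fun i => hD _ _, ?_⟩
  intro η hη
  rw [mem_iInter] at hη ⊢
  intro i
  apply hDA
  rw [mem_iInter]
  intro j
  simpa using hη (e (i, j))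

theorem Comeager.inter (hκ : κ.IsRegular) {A B : Set (Cantor κ)} (hA : Comeager A)
    (hB : Comeager B) : Comeager (A ∩ B) := by
  classical
  obtain ⟨b⟩ := nonempty_below hκ
  obtain ⟨c, hc⟩ := exists_gt_below hκ b
  have h := comeager_iInter hκ (A := fun i => if i = b then A else B) fun i => by
    split_ifs
    exacts [hA, hB]
  refine h.mono fun x hx => ?_
  rw [mem_iInter] at hx
  have h1 := hx b
  have h2 := hx c
  rw [if_pos rfl] at h1
  rw [if_neg hc.ne'] at h2
  exact ⟨h1, h2⟩

theorem Comeager.preimage_homeomorph {A : Set (Cantor κ)} (hA : Comeager A)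
    (t : Cantor κ ≃ₜ Cantor κ) : Comeager (t ⁻¹' A) := by
  obtain ⟨D, hD, hDA⟩ := hA
  refine ⟨fun i => t ⁻¹' D i, fun i => ⟨(hD i).1.preimage t.continuous,
    (hD i).2.preimage t.isOpenMap⟩, ?_⟩
  rw [← preimage_iInter]
  exact preimage_mono hDA

/-- The Baire category theorem for `2^κ`. -/
theorem Comeager.exists_agree (hκ : κ.IsRegular) {A : Set (Cantor κ)} (hA : Comeager A)
    (δ : Below κ) (x : Cantor κ) : ∃ y ∈ A, ∀ γ < δ, y γ = x γ := by
  obtain ⟨D, hD, hDA⟩ := hA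
  -- The conditions on `δ` matter at stage 0 only: the union of no stages has length 0, so the first
  -- stage has to restore the prescribed segment of `x` itself.
  have key : ∀ (i : Below κ) (c : Stage κ Bool), ∃ c' : Stage κ Bool, c.Extends c' ∧
      (δ < c'.1 ∧ ∀ γ < δ, c'.2 γ = c.2 γ) ∧
      ∀ y : Cantor κ, (∀ γ < c'.1, y γ = c'.2 γ) → y ∈ D i := by
    intro i c
    obtain ⟨y, hy, hyD⟩ := (hD i).2.inter_open_nonempty _
      (isOpen_setOf_agree (max c.1 δ) c.2) ⟨c.2, fun _ _ => rfl⟩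
    obtain ⟨a, ha⟩ := (isOpen_cantor_iff hκ).1 (hD i).1 y hyD
    obtain ⟨b, hb⟩ := exists_gt_below hκ (max (max a c.1) δ)
    refine ⟨(b, y), ⟨(le_max_right _ _).trans_lt ((le_max_left _ _).trans_lt hb),
        fun γ hγ => hy γ (lt_max_of_lt_left hγ)⟩,
      ⟨(le_max_right _ _).trans_lt hb, fun γ hγ => hy γ (lt_max_of_lt_right hγ)⟩, fun z hz => ha z fun γ hγ => hz γ ?_⟩
    exact hγ.trans ((le_max_left _ _).trans_lt ((le_max_left _ _).trans_lt hb))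
  choose ext hext hδ hin using key
  let c₀ : Stage κ Bool := (δ, x)
  let r := runStage c₀ ext
  have hlt : ∀ γ, ∃ j, γ < (r j).1 := fun γ => by
    obtain ⟨j, hj⟩ := exists_gt_below hκ γ
    exact ⟨j, hj.trans_le ((strictMono_runStage hκ hext).le_apply)⟩
  choose j hj using hlt
  let y : Cantor κ := fun γ => (r (j γ)).2 γ
  have hy : ∀ i, ∀ γ < (r i).1, y γ = (r i).2 γ := by
    intro i γ hγ
    rcases lt_trichotomy (j γ) i with h | h | h
    · exact ((extends_runStage hκ hext i (j γ) h).2 γ (hj γ)).symm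
    · rw [← h]
    · exact (extends_runStage hκ hext (j γ) i h).2 γ hγ
  refine ⟨y, hDA (mem_iInter.2 fun i => ?_), fun γ hγ => ?_⟩
  · refine hin i (preStage c₀ ext i) y ?_
    rw [← runStage_eq (c₀ := c₀) (ext := ext)]
    exact hy i
  · let o : Below κ := ⟨0, hκ.ord_pos⟩
    have h1 := hδ o (preStage c₀ ext o)
    rw [← runStage_eq (c₀ := c₀) (ext := ext), preStage_snd_of_forall_not_lt
      fun j => not_lt.2 (zero_le (a := j.1))] at h1
    rw [hy o γ (hγ.trans h1.1)]
    exact h1.2 γ hγ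

end Baire

/-! ### The Baire property and generic continuity of Borel functions. -/

section Generic

variable {κ : Cardinal.{u}}

/-- The pointwise exclusive disjunction `η △ ξ`. -/
def xorCantor (η ξ : Cantor κ) : Cantor κ := fun γ => xor (η γ) (ξ γ)

/-- Translation by `t`, as a homeomorphism. -/
def xorHomeomorph (hκ : κ.IsRegular) (t : Cantor κ) : Cantor κ ≃ₜ Cantor κ :=
  have h : Continuous fun x : Cantor κ => xorCantor x t :=
    continuous_of_local hκ fun γ => by
      obtain ⟨b, hb⟩ := exists_gt_below hκ γ
      exact ⟨b, fun η ξ h => by simp only [xorCantor, h γ hb]⟩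
  { toFun := fun x => xorCantor x t
    invFun := fun x => xorCantor x t
    left_inv := fun x => by funext γ; simp [xorCantor]
    right_inv := fun x => by funext γ; simp [xorCantor]
    continuous_toFun := h
    continuous_invFun := h }

/-- Any two initial segments of the same length extend to members of a comeager set whose
difference is constant from there on. -/
theorem Comeager.exists_pair (hκ : κ.IsRegular) {A : Set (Cantor κ)} (hA : Comeager A)
    (δ : Below κ) (x y : Cantor κ) (k : Bool) :
    ∃ x' ∈ A, ∃ y' ∈ A, (∀ γ < δ, x' γ = x γ) ∧ (∀ γ < δ, y' γ = y γ) ∧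
      ∀ γ, δ ≤ γ → xor (x' γ) (y' γ) = k := by
  classical
  let t : Cantor κ := fun γ => if γ < δ then xor (x γ) (y γ) else k
  -- Take a point of `A` whose translate by `t` is in `A` as well. The translation turns the segment
  -- of `x` into that of `y` and makes the difference `k` beyond `δ`.
  obtain ⟨x', hx', hag⟩ := (hA.inter hκ (hA.preimage_homeomorph (xorHomeomorph hκ t))).exists_agree
    hκ δ x
  refine ⟨x', hx'.1, xorCantor x' t, hx'.2, hag, fun γ hγ => ?_, fun γ hγ => ?_⟩
  · simp [xorCantor, t, hγ, hag γ hγ]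
  · simp [xorCantor, t, not_lt.2 hγ]

/-- `A` coincides with an open set on a comeager set. -/
def HasBaireProperty (A : Set (Cantor κ)) : Prop :=
  ∃ U, IsOpen U ∧ Comeager {η | η ∈ A ↔ η ∈ U}

theorem HasBaireProperty.compl (hκ : κ.IsRegular) {A : Set (Cantor κ)}
    (hA : HasBaireProperty A) : HasBaireProperty Aᶜ := by
  obtain ⟨U, hU, hAU⟩ := hA
  -- The boundary of an open set is nowhere dense.
  have h : Comeager (U ∪ (closure U)ᶜ) := by
    refine comeager_of_isOpen (hU.union isClosed_closure.isOpen_compl) ?_ hκ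
    rw [dense_iff_inter_open]
    intro V hV hne
    by_cases hVU : (V ∩ U).Nonempty
    · exact hVU.mono (inter_subset_inter_right _ subset_union_left)
    · obtain ⟨x, hx⟩ := hne
      refine ⟨x, hx, Or.inr fun hcl => hVU ?_⟩
      exact mem_closure_iff.1 hcl V hV hx
  refine ⟨(closure U)ᶜ, isClosed_closure.isOpen_compl, (hAU.inter hκ h).mono ?_⟩
  rintro η ⟨h1, h2⟩
  have h1' : η ∈ A ↔ η ∈ U := h1
  change η ∉ A ↔ η ∉ closure U
  rw [h1']
  refine ⟨fun h3 => h2.resolve_left h3, fun h3 h4 => h3 (subset_closure h4)⟩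

theorem HasBaireProperty.iUnion (hκ : κ.IsRegular) {A : Below κ → Set (Cantor κ)}
    (hA : ∀ i, HasBaireProperty (A i)) : HasBaireProperty (⋃ i, A i) := by
  choose U hU hAU using hA
  refine ⟨⋃ i, U i, isOpen_iUnion hU, (comeager_iInter hκ hAU).mono ?_⟩
  intro η hη
  rw [mem_iInter] at hη
  have hη' : ∀ i, η ∈ A i ↔ η ∈ U i := hη
  change η ∈ ⋃ i, A i ↔ η ∈ ⋃ i, U i
  simp only [mem_iUnion, hη']

theorem IsBorelSet.hasBaireProperty (hκ : κ.IsRegular) {A : Set (Cantor κ)}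
    (hA : IsBorelSet κ A) : HasBaireProperty A := by
  induction hA with
  | of_isOpen U hU =>
    exact ⟨U, hU, (comeager_of_isOpen isOpen_univ dense_univ hκ).mono fun _ _ => Iff.rfl⟩
  | compl A _ ih => exact ih.compl hκ
  | iUnion A _ ih => exact HasBaireProperty.iUnion hκ ih
  | iInter A _ ih =>
    have := (HasBaireProperty.iUnion hκ fun i => (ih i).compl hκ).compl hκ
    rwa [← compl_iInter, compl_compl] at this

/-- Borel functions are continuous on a comeager set. -/
theorem IsBorelFun.exists_comeager (hκ : κ.IsRegular) {f : Cantor κ → Cantor κ}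
    (hf : IsBorelFun κ f) :
    ∃ D : Set (Cantor κ), Comeager D ∧ ∀ η ∈ D, ∀ θ, ∃ δ, ∀ ξ ∈ D, (∀ γ < δ, ξ γ = η γ) →
      ∀ γ < θ, f ξ γ = f η γ := by
  -- It suffices to treat the `κ` many conditions on single bits. On the comeager set each of them
  -- agrees with an open condition.
  have h : ∀ (k : Bool) (γ : Below κ), HasBaireProperty {η | f η γ = k} := fun k γ =>
    (hf _ (isOpen_setOf_apply hκ γ k)).hasBaireProperty hκ
  choose U hU hD using h
  refine ⟨_, (comeager_iInter hκ (hD true)).inter hκ (comeager_iInter hκ (hD false)), ?_⟩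
  have key : ∀ η ∈ (⋂ i, {η | η ∈ {η | f η i = true} ↔ η ∈ U true i}) ∩
      ⋂ i, {η | η ∈ {η | f η i = false} ↔ η ∈ U false i}, ∀ k i, f η i = k ↔ η ∈ U k i := by
    rintro η ⟨h1, h2⟩ k i
    rw [mem_iInter] at h1 h2
    cases k
    exacts [h2 i, h1 i]
  intro η hη θ
  have h2 : ∀ γ, ∃ δ, ∀ ξ : Cantor κ, (∀ β < δ, ξ β = η β) → ξ ∈ U (f η γ) γ := fun γ =>
    (isOpen_cantor_iff hκ).1 (hU (f η γ) γ) η ((key η hη _ γ).1 rfl)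
  choose g hg using h2
  obtain ⟨b, hb⟩ := exists_forall_lt_Iio hκ fun γ : Set.Iio θ => g γ.1
  exact ⟨b, fun ξ hξ hag γ hγ => (key ξ hξ _ γ).2
    (hg γ ξ fun β hβ => hag β (hβ.trans (hb ⟨γ, hγ⟩)))⟩

end Generic

/-! ### Smooth relations and `E₀`. -/

section Smooth

variable {κ : Cardinal.{u}}

theorem continuous_apply_cantor (hκ : κ.IsRegular) (γ : Below κ) :
    Continuous fun η : Cantor κ => η γ := by
  rw [continuous_discrete_rng]
  exact fun k => isOpen_setOf_apply hκ γ k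

theorem isClosed_setOf_eq_cantor (hκ : κ.IsRegular) :
    IsClosed {p : Cantor κ × Cantor κ | p.1 = p.2} := by
  have : {p : Cantor κ × Cantor κ | p.1 = p.2} = ⋂ γ, {p | p.1 γ = p.2 γ} := by
    ext p
    rw [mem_iInter]
    exact funext_iff
  rw [this]
  exact isClosed_iInter fun γ => isClosed_eq ((continuous_apply_cantor hκ γ).comp continuous_fst)
    ((continuous_apply_cantor hκ γ).comp continuous_snd)

/-- Smooth relations: those that are continuously reducible to the identity. -/
def Smooth (P : Cantor κ → Cantor κ → Prop) : Prop :=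
  ∃ a : Cantor κ → Cantor κ, Continuous a ∧ ∀ η ξ, P η ξ ↔ a η = a ξ

variable {P Q : Cantor κ → Cantor κ → Prop}

theorem Smooth.equivalence (h : Smooth P) : Equivalence P := by
  obtain ⟨a, -, ha⟩ := h
  exact ⟨fun η => (ha _ _).2 rfl, fun h => (ha _ _).2 ((ha _ _).1 h).symm,
    fun h h' => (ha _ _).2 (((ha _ _).1 h).trans ((ha _ _).1 h'))⟩

theorem Smooth.isClosed (hκ : κ.IsRegular) (h : Smooth P) :
    IsClosed {p : Cantor κ × Cantor κ | P p.1 p.2} := by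
  obtain ⟨a, hc, ha⟩ := h
  simp only [ha]
  exact (isClosed_setOf_eq_cantor hκ).preimage
    ((hc.comp continuous_fst).prodMk (hc.comp continuous_snd))

/-- The failure of a smooth relation is detected by initial segments. -/
theorem Smooth.exists_not (hκ : κ.IsRegular) (h : Smooth P) {η ξ : Cantor κ} (hn : ¬ P η ξ) :
    ∃ θ, ∀ η' ξ' : Cantor κ, (∀ γ < θ, η' γ = η γ) → (∀ γ < θ, ξ' γ = ξ γ) → ¬ P η' ξ' := by
  obtain ⟨a, hc, ha⟩ := h
  rw [ha] at hn
  obtain ⟨γ, hγ⟩ := Function.ne_iff.1 hn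
  obtain ⟨b, hb⟩ := exists_gt_below hκ γ
  obtain ⟨δ, hδ⟩ := local_of_continuous hκ hc η b
  obtain ⟨δ', hδ'⟩ := local_of_continuous hκ hc ξ b
  refine ⟨max δ δ', fun η' ξ' h1 h2 h3 => hγ ?_⟩
  rw [ha] at h3
  rw [← hδ η' (fun β hβ => h1 β (lt_max_of_lt_left hβ)) γ hb,
    ← hδ' ξ' (fun β hβ => h2 β (lt_max_of_lt_right hβ)) γ hb, h3]

theorem E0.equivalence (hκ : κ.IsRegular) : Equivalence (E0 κ) := by
  have := nonempty_below hκ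
  refine ⟨fun η => ?_, fun {η ξ} h => ?_, fun {η ξ ζ} h h' => ?_⟩
  · simp [E0]
  · simpa only [E0, ne_comm] using h
  · refine (h.union h').mono fun γ hγ => ?_
    by_contra hcon
    simp only [mem_union, mem_ofPred_eq, not_or, not_not] at hcon
    exact hγ (hcon.1.trans hcon.2)

theorem E0.isBorel (hκ : κ.IsRegular) :
    IsBorelSet κ {p : Cantor κ × Cantor κ | E0 κ p.1 p.2} := by
  have : {p : Cantor κ × Cantor κ | E0 κ p.1 p.2} =
      ⋃ b, ⋂ γ : Set.Ioi b, {p | p.1 γ.1 = p.2 γ.1} := by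
    ext p
    rw [mem_iUnion]
    refine exists_congr fun b => ?_
    rw [mem_iInter]
    constructor
    · rintro h ⟨γ, hγ⟩
      by_contra hne
      exact absurd (h hne) (not_le.2 hγ)
    · intro h γ hγ
      by_contra hlt
      exact hγ (h ⟨γ, not_le.1 hlt⟩)
  rw [this]
  refine IsBorelSet.iUnion _ fun b => IsBorelSet.of_isClosed (isClosed_iInter fun γ => ?_)
  exact isClosed_eq ((continuous_apply_cantor hκ γ.1).comp continuous_fst)
    ((continuous_apply_cantor hκ γ.1).comp continuous_snd)

end Smooth

/-! ### Even and odd halves. -/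

section Merge

variable {κ : Cardinal.{u}}

theorem div_two_le (γ : Ordinal.{u}) : γ / 2 ≤ γ := by
  have h := Ordinal.mul_div_le γ 2
  exact (Ordinal.le_mul_right _ (by simp)).trans h

/-- The element of `2^κ` with even half `a` and odd half `b`. -/
noncomputable def mergeCantor (a b : Cantor κ) : Cantor κ := fun γ =>
  if γ.1 % 2 = 0 then a ⟨γ.1 / 2, (div_two_le γ.1).trans_lt γ.2⟩
  else b ⟨γ.1 / 2, (div_two_le γ.1).trans_lt γ.2⟩

theorem two_mul_div_two (β : Ordinal.{u}) : 2 * β / 2 = β := Ordinal.mul_div_cancel β (by simp)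

theorem two_mul_add_one_div_two (β : Ordinal.{u}) : (2 * β + 1) / 2 = β := by
  rw [Ordinal.mul_add_div _ (by simp), Ordinal.div_eq_zero_of_lt (by simp), add_zero]

theorem two_mul_add_one_mod_two (β : Ordinal.{u}) : (2 * β + 1) % 2 = 1 := by
  rw [Ordinal.mul_add_mod_self, Ordinal.mod_eq_of_lt (by simp)]

theorem even_or_odd_ordinal (γ : Ordinal.{u}) :
    γ % 2 = 0 ∧ γ = 2 * (γ / 2) ∨ γ % 2 = 1 ∧ γ = 2 * (γ / 2) + 1 := by
  have h1 := Ordinal.div_add_mod γ 2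
  have h2 := Ordinal.mod_lt γ (b := 2) (by simp)
  rw [← one_add_one_eq_two, ← Order.succ_eq_add_one, Order.lt_succ_iff] at h2
  rcases h2.lt_or_eq with h | h
  · rw [Order.lt_one_iff] at h
    simp only [Order.succ_eq_add_one, one_add_one_eq_two] at h
    rw [h, add_zero] at h1
    exact Or.inl ⟨h, h1.symm⟩
  · simp only [Order.succ_eq_add_one, one_add_one_eq_two] at h
    rw [h] at h1
    exact Or.inr ⟨h, h1.symm⟩

variable (hκ : Cardinal.aleph0 ≤ κ)

theorem evenPart_merge (a b : Cantor κ) : evenPart hκ (mergeCantor a b) = a := by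
  funext β
  simp only [evenPart, mergeCantor, Ordinal.mul_mod, two_mul_div_two, if_true]

theorem oddPart_merge (a b : Cantor κ) : oddPart hκ (mergeCantor a b) = b := by
  funext β
  simp only [oddPart, mergeCantor, two_mul_add_one_mod_two, two_mul_add_one_div_two,
    one_ne_zero, if_false]

theorem continuous_evenPart (hκ' : κ.IsRegular) : Continuous (evenPart hκ) :=
  continuous_of_local hκ' fun γ => by
    obtain ⟨b, hb⟩ := exists_gt_below hκ' ⟨2 * γ.1, (two_mul_add_lt_ord hκ γ).1⟩
    exact ⟨b, fun η ξ h => h _ hb⟩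

theorem continuous_oddPart (hκ' : κ.IsRegular) : Continuous (oddPart hκ) :=
  continuous_of_local hκ' fun γ => by
    obtain ⟨b, hb⟩ := exists_gt_below hκ' ⟨2 * γ.1 + 1, (two_mul_add_lt_ord hκ γ).2⟩
    exact ⟨b, fun η ξ h => h _ hb⟩

theorem Continuous.mergeCantor (hκ' : κ.IsRegular) {f g : Cantor κ → Cantor κ}
    (hf : Continuous f) (hg : Continuous g) :
    Continuous fun η => mergeCantor (f η) (g η) := by
  refine ⟨fun U hU => ?_⟩
  rw [isOpen_cantor_iff hκ'] at hU ⊢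
  intro η hη
  obtain ⟨α, hα⟩ := hU _ hη
  obtain ⟨δ, hδ⟩ := local_of_continuous hκ' hf η α
  obtain ⟨δ', hδ'⟩ := local_of_continuous hκ' hg η α
  refine ⟨max δ δ', fun ξ h => hα _ fun γ hγ => ?_⟩
  have hγ' : (⟨γ.1 / 2, (div_two_le γ.1).trans_lt γ.2⟩ : Below κ) < α :=
    lt_of_le_of_lt (b := γ) (div_two_le γ.1) hγ
  simp only [_root_.mergeCantor]
  rw [hδ ξ (fun β hβ => h β (lt_max_of_lt_left hβ)) _ hγ',
    hδ' ξ (fun β hβ => h β (lt_max_of_lt_right hβ)) _ hγ']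

theorem E0_iff {η ξ : Cantor κ} : E0 κ η ξ ↔ ∃ b, ∀ γ, b < γ → η γ = ξ γ := by
  refine exists_congr fun b => ⟨fun h γ hγ => ?_, fun h γ hγ => ?_⟩
  · by_contra hne
    exact absurd (h hne) (not_le.2 hγ)
  · by_contra hlt
    exact hγ (h γ (not_le.1 hlt))

/-- Halving and doubling ordinals both preserve boundedness in `κ`. Hence `E₀` absorbs products with
itself. -/
theorem E0_iff_even_odd {η ξ : Cantor κ} :
    E0 κ η ξ ↔ E0 κ (evenPart hκ η) (evenPart hκ ξ) ∧ E0 κ (oddPart hκ η) (oddPart hκ ξ) := by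
  simp only [E0_iff]
  constructor
  · rintro ⟨b, hb⟩
    refine ⟨⟨b, fun γ hγ => hb _ (lt_of_lt_of_le hγ ?_)⟩, ⟨b, fun γ hγ => hb _ (lt_of_lt_of_le hγ ?_)⟩⟩
    · exact Ordinal.le_mul_right _ (by simp)
    · exact (Ordinal.le_mul_right _ (by simp)).trans le_self_add
  · rintro ⟨⟨b, hb⟩, ⟨c, hc⟩⟩
    refine ⟨⟨2 * (max b c).1 + 1, (two_mul_add_lt_ord hκ _).2⟩, fun γ hγ => ?_⟩
    have hγ' : 2 * (max b c).1 + 1 < γ.1 := hγ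
    have hlt : (max b c).1 < γ.1 / 2 := by
      by_contra hle
      rw [not_lt] at hle
      have h2 : 2 * (γ.1 / 2) ≤ 2 * (max b c).1 := mul_le_mul_right hle 2
      rcases even_or_odd_ordinal γ.1 with ⟨-, h⟩ | ⟨-, h⟩
      · exact absurd (h.le.trans (h2.trans le_self_add)) hγ'.not_ge
      · exact absurd (h.le.trans (add_le_add_left h2 1)) hγ'.not_ge
    let γ' : Below κ := ⟨γ.1 / 2, (div_two_le γ.1).trans_lt γ.2⟩
    have h1 := hb γ' (lt_of_le_of_lt (le_max_left b c) hlt)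
    have h2 := hc γ' (lt_of_le_of_lt (le_max_right b c) hlt)
    rcases even_or_odd_ordinal γ.1 with ⟨-, h⟩ | ⟨-, h⟩
    · have e : (⟨2 * γ'.1, (two_mul_add_lt_ord hκ γ').1⟩ : Below κ) = γ := Subtype.ext h.symm
      simpa only [evenPart, e] using h1
    · have e : (⟨2 * γ'.1 + 1, (two_mul_add_lt_ord hκ γ').2⟩ : Below κ) = γ := Subtype.ext h.symm
      simpa only [oddPart, e] using h2

theorem E0_merge_iff (hκ : Cardinal.aleph0 ≤ κ) {a b a' b' : Cantor κ} :
    E0 κ (mergeCantor a b) (mergeCantor a' b') ↔ E0 κ a a' ∧ E0 κ b b' := by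
  rw [E0_iff_even_odd hκ, evenPart_merge, evenPart_merge, oddPart_merge, oddPart_merge]

end Merge

/-! ### Coding initial segments by ordinals below `κ`. -/

section Code

variable {κ : Cardinal.{u}}

/-- The constant sequence `0`. -/
def zeroCantor (κ : Cardinal.{u}) : Cantor κ := fun _ => false

open Classical in
/-- The element of `2^κ` that coincides with `η` below `θ` and is constantly `0` from there on. -/
noncomputable def trunc (θ : Below κ) (η : Cantor κ) : Cantor κ :=
  fun γ => if γ < θ then η γ else false

theorem trunc_of_lt {θ γ : Below κ} (h : γ < θ) (η : Cantor κ) : trunc θ η γ = η γ := if_pos h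

theorem trunc_of_le {θ γ : Below κ} (h : θ ≤ γ) (η : Cantor κ) : trunc θ η γ = false :=
  if_neg (not_lt.2 h)

theorem trunc_congr {θ : Below κ} {η ξ : Cantor κ} (h : ∀ γ < θ, η γ = ξ γ) :
    trunc θ η = trunc θ ξ := by
  funext γ
  rcases lt_or_ge γ θ with hγ | hγ
  · rw [trunc_of_lt hγ, trunc_of_lt hγ, h γ hγ]
  · rw [trunc_of_le hγ, trunc_of_le hγ]

/-- This is the place where `κ^{<κ} = κ` enters: it bounds by `κ` the number of all initial
segments. -/
theorem exists_enumeration (hκ : κ.IsRegular) (hpow : κ ^< κ = κ) :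
    ∃ e : Below κ → Below κ × Cantor κ, ∀ θ η, ∃ β, e β = (θ, trunc θ η) := by
  classical
  obtain ⟨b⟩ := nonempty_below hκ
  have hc : Cardinal.mk (Σ θ : Below κ, (Set.Iio θ → Bool)) ≤ Cardinal.mk (Below κ) := by
    rw [Cardinal.mk_sigma, mk_below]
    have h1 : ∀ θ : Below κ, Cardinal.mk (Set.Iio θ → Bool) ≤ Cardinal.lift.{u + 1} κ := by
      intro θ
      have h2 : (2 : Cardinal.{u}) ^ θ.1.card ≤ κ := by
        refine (Cardinal.power_le_power_right ?_).trans
          ((Cardinal.le_powerlt κ (Cardinal.lt_ord.1 θ.2)).trans hpow.le)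
        exact (Cardinal.natCast_lt_aleph0 (n := 2)).le.trans hκ.aleph0_le
      rw [Cardinal.mk_arrow, mk_Iio_below]
      have := Cardinal.lift_le.{u + 1}.2 h2
      simpa using this
    refine (Cardinal.sum_le_sum _ (fun _ => Cardinal.lift.{u + 1} κ) h1).trans ?_
    rw [Cardinal.sum_const, mk_below, Cardinal.lift_id,
      Cardinal.mul_eq_self (by simpa using hκ.aleph0_le)]
  obtain ⟨g⟩ := Cardinal.le_def _ _ |>.1 hc
  have : Nonempty (Σ θ : Below κ, (Set.Iio θ → Bool)) := ⟨⟨b, fun _ => false⟩⟩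
  let d : (Σ θ : Below κ, (Set.Iio θ → Bool)) → Below κ × Cantor κ := fun s =>
    (s.1, fun γ => if h : γ < s.1 then s.2 ⟨γ, h⟩ else false)
  refine ⟨fun β => d (Function.invFun g β), fun θ η => ⟨g ⟨θ, fun γ => η γ.1⟩, ?_⟩⟩
  have hs : Function.invFun g (g ⟨θ, fun γ => η γ.1⟩) = ⟨θ, fun γ => η γ.1⟩ :=
    Function.leftInverse_invFun g.injective _
  simp only [hs]
  refine Prod.ext rfl (funext fun γ => ?_)
  by_cases h : γ < θ
  · exact (dif_pos h).trans (trunc_of_lt h η).symm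
  · exact (dif_neg h).trans (trunc_of_le (not_lt.1 h) η).symm

/-- Relations that are determined by what they say about initial segments are smooth. -/
theorem smooth_of_local (hκ : κ.IsRegular) (hpow : κ ^< κ = κ)
    {L : Cantor κ → Cantor κ → Prop} (hL : Equivalence L)
    (h : ∀ η ξ, L η ξ ↔ ∀ θ, L (trunc θ η) (trunc θ ξ)) : Smooth L := by
  classical
  obtain ⟨e, he⟩ := exists_enumeration hκ hpow
  -- The bit at `β` asks whether the truncation of `η` is related to the listed segment. The
  -- sequence of bits thus records the classes of all truncations.
  refine ⟨fun η β => decide (L (e β).2 (trunc (e β).1 η)), continuous_of_local hκ fun γ => ?_,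
    fun η ξ => ?_⟩
  · refine ⟨(e γ).1, fun η ξ hag => ?_⟩
    have : trunc (e γ).1 ξ = trunc (e γ).1 η := trunc_congr hag
    simp only [this]
  · rw [h]
    constructor
    · intro hl
      funext β
      rw [decide_eq_decide]
      exact ⟨fun h1 => hL.trans h1 (hl _), fun h1 => hL.trans h1 (hL.symm (hl _))⟩
    · intro hl θ
      -- At the code of the truncation of `η` itself the bit of `η` is true by reflexivity, hence so
      -- is the bit of `ξ`.
      obtain ⟨β, hβ⟩ := he θ η
      have h1 := congrFun hl β
      rw [decide_eq_decide, hβ] at h1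
      exact h1.1 (hL.refl _)

/-- The identity is continuously reducible to `E₀`. -/
theorem exists_code (hκ : κ.IsRegular) (hpow : κ ^< κ = κ) :
    ∃ c : Cantor κ → Cantor κ, Continuous c ∧ ∀ η ξ, E0 κ (c η) (c ξ) ↔ η = ξ := by
  classical
  obtain ⟨e, he⟩ := exists_enumeration hκ hpow
  refine ⟨fun η β => decide ((e β).2 = trunc (e β).1 η), continuous_of_local hκ fun γ => ?_,
    fun η ξ => ⟨fun h => ?_, fun h => h ▸ (E0.equivalence hκ).refl _⟩⟩
  · refine ⟨(e γ).1, fun η ξ hag => ?_⟩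
    have : trunc (e γ).1 ξ = trunc (e γ).1 η := trunc_congr hag
    simp only [this]
  · by_contra hne
    obtain ⟨γ, hγ⟩ := Function.ne_iff.1 hne
    choose β hβ using fun θ => he θ η
    have hinj : Function.Injective β := fun θ θ' hθ => by
      have := (hβ θ).symm.trans ((congrArg e hθ).trans (hβ θ'))
      exact congrArg Prod.fst this
    -- The codes of the segments of `η` longer than `γ` are true for `η` and false for `ξ`. They are
    -- distinct, so there are `κ` of them, and the difference is unbounded.
    have hmem : β '' Set.Ioi γ ⊆ {α | decide ((e α).2 = trunc (e α).1 η) ≠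
        decide ((e α).2 = trunc (e α).1 ξ)} := by
      rintro _ ⟨θ, hθ, rfl⟩ heq
      rw [decide_eq_decide, hβ θ] at heq
      have h1 : trunc θ η γ = trunc θ ξ γ := congrFun (heq.1 rfl) γ
      rw [trunc_of_lt hθ, trunc_of_lt hθ] at h1
      exact hγ h1
    have h1 := mk_lt_of_bddAbove hκ (BddAbove.mono hmem h)
    rw [Cardinal.mk_image_eq hinj] at h1
    obtain ⟨b, hb⟩ := bddAbove_of_mk_lt hκ h1
    obtain ⟨c, hc⟩ := exists_gt_below hκ (max γ b)
    exact absurd (hb (show c ∈ Set.Ioi γ from (le_max_left _ _).trans_lt hc))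
      ((le_max_right _ _).trans_lt hc).not_ge

end Code

/-! ### Products of a smooth relation with an intersection of a smooth relation and `E₀`. -/

section Tensor

variable {κ : Cardinal.{u}} {P Q L : Cantor κ → Cantor κ → Prop}

theorem smooth_id (κ : Cardinal.{u}) : Smooth (idRel κ) := ⟨id, continuous_id, fun _ _ => Iff.rfl⟩

theorem Smooth.and (hκ : κ.IsRegular) (hP : Smooth P) (hQ : Smooth Q) :
    Smooth fun η ξ => P η ξ ∧ Q η ξ := by
  obtain ⟨a, hac, ha⟩ := hP
  obtain ⟨b, hbc, hb⟩ := hQ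
  refine ⟨fun η => mergeCantor (a η) (b η), hac.mergeCantor hκ hbc, fun η ξ => ?_⟩
  simp only [ha, hb]
  constructor
  · rintro ⟨h1, h2⟩
    rw [h1, h2]
  · intro h
    have h1 := congrArg (evenPart hκ.aleph0_le) h
    have h2 := congrArg (oddPart hκ.aleph0_le) h
    rw [evenPart_merge, evenPart_merge] at h1
    rw [oddPart_merge, oddPart_merge] at h2
    exact ⟨h1, h2⟩

theorem Smooth.comp {f : Cantor κ → Cantor κ} (hP : Smooth P) (hf : Continuous f) :
    Smooth fun η ξ => P (f η) (f ξ) := by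
  obtain ⟨a, hac, ha⟩ := hP
  exact ⟨a ∘ f, hac.comp hf, fun η ξ => ha _ _⟩

theorem Smooth.tensor (hκ : κ.IsRegular) (hP : Smooth P) (hQ : Smooth Q) :
    Smooth (tensor hκ.aleph0_le P Q) :=
  (hP.comp (continuous_evenPart _ hκ)).and hκ (hQ.comp (continuous_oddPart _ hκ))

/-- The normal form on which everything rests: a relation that is smooth if `P` and `L` are,
together with `E₀` of one continuous image. -/
theorem tensor_inter_E0_iff (hκ : Cardinal.aleph0 ≤ κ) {η ξ : Cantor κ} :
    tensor hκ P (fun η ξ => L η ξ ∧ E0 κ η ξ) η ξ ↔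
      tensor hκ P L η ξ ∧ E0 κ (oddPart hκ η) (oddPart hκ ξ) := by
  simp only [tensor, and_assoc]

theorem isBorelEquiv_tensor (hκ : κ.IsRegular) (hP : Smooth P) (hL : Smooth L) :
    IsBorelEquiv κ (tensor hκ.aleph0_le P fun η ξ => L η ξ ∧ E0 κ η ξ) := by
  have hs := hP.tensor hκ hL
  constructor
  · have h1 := hs.equivalence
    have h2 := E0.equivalence hκ
    simp only [funext fun η => funext fun ξ => propext (tensor_inter_E0_iff (P := P) (L := L)
      hκ.aleph0_le (η := η) (ξ := ξ))]
    exact ⟨fun η => ⟨h1.refl _, h2.refl _⟩, fun h => ⟨h1.symm h.1, h2.symm h.2⟩,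
      fun h h' => ⟨h1.trans h.1 h'.1, h2.trans h.2 h'.2⟩⟩
  · simp only [tensor_inter_E0_iff]
    refine IsBorelSet.inter hκ (IsBorelSet.of_isClosed (hs.isClosed hκ)) ?_
    have hc := continuous_oddPart hκ.aleph0_le hκ
    exact IsBorelSet.preimage (f := fun p : Cantor κ × Cantor κ =>
      (oddPart hκ.aleph0_le p.1, oddPart hκ.aleph0_le p.2))
      (fun U hU => IsBorelSet.of_isOpen _ (hU.preimage
        ((hc.comp continuous_fst).prodMk (hc.comp continuous_snd)))) (E0.isBorel hκ)

/-- Equality of the smooth invariants is converted into `E₀` by the code of `exists_code`. It is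
then merged with the odd half, since `E₀` absorbs products with itself. -/
theorem reducible_E0 (hκ : κ.IsRegular) (hpow : κ ^< κ = κ) (hP : Smooth P) (hL : Smooth L) :
    BorelReducible κ (tensor hκ.aleph0_le P fun η ξ => L η ξ ∧ E0 κ η ξ) (E0 κ) := by
  obtain ⟨a, hac, ha⟩ := hP.tensor hκ hL
  obtain ⟨c, hcc, hc⟩ := exists_code hκ hpow
  refine ⟨fun η => mergeCantor (c (a η)) (oddPart hκ.aleph0_le η), IsBorelFun.of_continuous
    ((hcc.comp hac).mergeCantor hκ (continuous_oddPart _ hκ)), fun η ξ => ?_⟩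
  simp only [E0_merge_iff hκ.aleph0_le, hc, ← ha, tensor_inter_E0_iff]

/-- A reduction to a product can be put together from its components, where the identity may take
the place of the first factor if it is reducible to it. -/
theorem reducible_tensor (hκ : κ.IsRegular) {R : Cantor κ → Cantor κ → Prop}
    {j a b : Cantor κ → Cantor κ} (hj : Continuous j) (hjP : ∀ η ξ, P (j η) (j ξ) ↔ η = ξ)
    (ha : Continuous a) (hb : Continuous b) (h : ∀ η ξ, R η ξ ↔ a η = a ξ ∧ Q (b η) (b ξ)) :
    BorelReducible κ R (tensor hκ.aleph0_le P Q) := by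
  refine ⟨fun η => mergeCantor (j (a η)) (b η), IsBorelFun.of_continuous
    ((hj.comp ha).mergeCantor hκ hb), fun η ξ => ?_⟩
  rw [tensor, evenPart_merge, evenPart_merge, oddPart_merge, oddPart_merge, hjP, h]

theorem idRel_reducible_tensor (hκ : κ.IsRegular) {j : Cantor κ → Cantor κ} (hj : Continuous j)
    (hjP : ∀ η ξ, P (j η) (j ξ) ↔ η = ξ) (hQ : ∀ η, Q η η) :
    BorelReducible κ (idRel κ) (tensor hκ.aleph0_le P Q) :=
  reducible_tensor hκ hj hjP continuous_id (continuous_const (y := zeroCantor κ))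
    fun _ _ => (and_iff_left (hQ _)).symm

theorem right_reducible_tensor (hκ : κ.IsRegular) (hP : ∀ η, P η η) :
    BorelReducible κ Q (tensor hκ.aleph0_le P Q) :=
  ⟨fun η => mergeCantor (zeroCantor κ) η, IsBorelFun.of_continuous
    (continuous_const.mergeCantor hκ continuous_id), fun _ _ => by
      simp only [tensor, evenPart_merge, oddPart_merge]
      exact ⟨fun h => ⟨hP _, h⟩, fun h => h.2⟩⟩

end Tensor

/-! ### The smooth relations given by local conditions on `η △ ξ`. -/

section Relations

variable {κ μ : Cardinal.{u}}

/-- The sequence `γ ↦ η (h γ)`. -/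
def reindex (h : Below κ → Below κ) (η : Cantor κ) : Cantor κ := fun γ => η (h γ)

/-- `d` is constant on some interval `(β, α)`. -/
def EventuallyConstBelow (d : Cantor κ) (α : Below κ) : Prop :=
  ∃ β < α, ∃ k : Bool, ∀ γ, β < γ → γ < α → d γ = k

theorem EventuallyConstBelow.congr {d d' : Cantor κ} {α β : Below κ}
    (h : EventuallyConstBelow d α) (hβ : β < α) (hd : ∀ γ, β < γ → γ < α → d' γ = d γ) :
    EventuallyConstBelow d' α := by
  obtain ⟨b, hb, k, hk⟩ := h
  exact ⟨max b β, max_lt hb hβ, k, fun γ h1 h2 =>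
    (hd γ ((le_max_right _ _).trans_lt h1) h2).trans (hk γ ((le_max_left _ _).trans_lt h1) h2)⟩

theorem EventuallyConstBelow.xor {d d' : Cantor κ} {α : Below κ}
    (h : EventuallyConstBelow d α) (h' : EventuallyConstBelow d' α) :
    EventuallyConstBelow (xorCantor d d') α := by
  obtain ⟨b, hb, k, hk⟩ := h
  obtain ⟨b', hb', k', hk'⟩ := h'
  refine ⟨max b b', max_lt hb hb', Bool.xor k k', fun γ h1 h2 => ?_⟩
  rw [xorCantor, hk γ ((le_max_left _ _).trans_lt h1) h2,
    hk' γ ((le_max_right _ _).trans_lt h1) h2]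

/-- Below every point of cofinality `μ`, the points of cofinality `μ` at which `η △ ξ` is not
eventually constant are bounded. -/
def ScatteredRel (κ μ : Cardinal.{u}) (η ξ : Cantor κ) : Prop :=
  ∀ α ∈ cofSet κ μ, ∃ β < α, ∀ δ ∈ cofSet κ μ, β < δ → δ < α →
    EventuallyConstBelow (xorCantor η ξ) δ

theorem xorCantor_trunc (θ : Below κ) (η ξ : Cantor κ) :
    xorCantor (trunc θ η) (trunc θ ξ) = trunc θ (xorCantor η ξ) := by
  funext γ
  rcases lt_or_ge γ θ with hγ | hγ
  · rw [xorCantor, trunc_of_lt hγ, trunc_of_lt hγ, trunc_of_lt hγ, xorCantor]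
  · rw [xorCantor, trunc_of_le hγ, trunc_of_le hγ, trunc_of_le hγ, Bool.xor_false]

theorem xorCantor_comm (η ξ : Cantor κ) : xorCantor η ξ = xorCantor ξ η :=
  funext fun _ => Bool.xor_comm _ _

theorem xorCantor_self (η : Cantor κ) : xorCantor η η = zeroCantor κ :=
  funext fun _ => Bool.xor_self _

theorem xorCantor_xorCantor (η ξ ζ : Cantor κ) :
    xorCantor (xorCantor η ξ) (xorCantor ξ ζ) = xorCantor η ζ := by
  funext γ
  simp only [xorCantor]
  cases η γ <;> cases ξ γ <;> cases ζ γ <;> rfl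

/-- The relation `η △ ξ ∈ Λ` is smooth if `Λ` is a subgroup that is determined by its restrictions
to initial segments. -/
theorem smooth_of_xor (hκ : κ.IsRegular) (hpow : κ ^< κ = κ) {Λ : Cantor κ → Prop}
    (h0 : Λ (zeroCantor κ)) (hx : ∀ d d', Λ d → Λ d' → Λ (xorCantor d d'))
    (hl : ∀ d, Λ d ↔ ∀ θ, Λ (trunc θ d)) : Smooth fun η ξ => Λ (xorCantor η ξ) := by
  refine smooth_of_local hκ hpow ⟨fun η => ?_, fun {η ξ} h => ?_, fun {η ξ ζ} h h' => ?_⟩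
    fun η ξ => ?_
  · rw [xorCantor_self]
    exact h0
  · rwa [xorCantor_comm]
  · rw [← xorCantor_xorCantor η ξ ζ]
    exact hx _ _ h h'
  · simp only [xorCantor_trunc]
    exact hl _

/-- A truncation below `α` leaves a tail of zeros, and one at or above `α` changes nothing below
`α`. So these conditions pass to and from initial segments, as smoothness requires. -/
theorem eventuallyConstBelow_trunc {d : Cantor κ} {α θ : Below κ}
    (h : EventuallyConstBelow d α) : EventuallyConstBelow (trunc θ d) α := by
  rcases lt_or_ge θ α with hθ | hθ
  · exact ⟨θ, hθ, false, fun γ h1 _ => trunc_of_le h1.le d⟩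
  · obtain ⟨β, hβ, -⟩ := id h
    exact h.congr hβ fun γ _ h2 => trunc_of_lt (h2.trans_le hθ) d

theorem EventuallyConstBelow.of_trunc {d : Cantor κ} {α θ : Below κ} (hθ : α ≤ θ)
    (h : EventuallyConstBelow (trunc θ d) α) : EventuallyConstBelow d α := by
  obtain ⟨β, hβ, -⟩ := id h
  exact h.congr hβ fun γ _ h2 => (trunc_of_lt (h2.trans_le hθ) d).symm

theorem smooth_eStar (hκ : κ.IsRegular) (hpow : κ ^< κ = κ) (hμ : μ.IsRegular)
    {Z : Set (Below κ)} (hZ : Z ⊆ cofSet κ μ) : Smooth (EStar κ Z) := by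
  refine smooth_of_xor hκ hpow (Λ := fun d => ∀ α ∈ Z, EventuallyConstBelow d α)
    (fun α hα => ?_) (fun d d' h h' α hα => (h α hα).xor (h' α hα)) fun d => ⟨fun h θ α hα => ?_,
      fun h α hα => ?_⟩
  · obtain ⟨β, hβ⟩ := exists_lt_of_mem_cofSet hμ (hZ hα)
    exact ⟨β, hβ, false, fun _ _ _ => rfl⟩
  · exact eventuallyConstBelow_trunc (h α hα)
  · exact (h α α hα).of_trunc le_rfl

theorem smooth_scatteredRel (hκ : κ.IsRegular) (hpow : κ ^< κ = κ) (hμ : μ.IsRegular) :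
    Smooth (ScatteredRel κ μ) := by
  refine smooth_of_xor hκ hpow (Λ := fun d => ∀ α ∈ cofSet κ μ, ∃ β < α, ∀ δ ∈ cofSet κ μ,
    β < δ → δ < α → EventuallyConstBelow d δ) (fun α hα => ?_) (fun d d' h h' α hα => ?_)
    fun d => ⟨fun h θ α hα => ?_, fun h α hα => ?_⟩
  · obtain ⟨β, hβ⟩ := exists_lt_of_mem_cofSet hμ hα
    exact ⟨β, hβ, fun δ _ h1 _ => ⟨β, h1, false, fun _ _ _ => rfl⟩⟩
  · obtain ⟨β, hβ, h1⟩ := h α hα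
    obtain ⟨β', hβ', h2⟩ := h' α hα
    exact ⟨max β β', max_lt hβ hβ', fun δ hδ h3 h4 =>
      (h1 δ hδ ((le_max_left _ _).trans_lt h3) h4).xor
        (h2 δ hδ ((le_max_right _ _).trans_lt h3) h4)⟩
  · obtain ⟨β, hβ, h1⟩ := h α hα
    exact ⟨β, hβ, fun δ hδ h3 h4 => eventuallyConstBelow_trunc (h1 δ hδ h3 h4)⟩
  · obtain ⟨β, hβ, h1⟩ := h α α hα
    exact ⟨β, hβ, fun δ hδ h3 h4 => (h1 δ hδ h3 h4).of_trunc h4.le⟩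

/-- Equality on the set `X`. -/
def eqOnRel (X : Set (Below κ)) (η ξ : Cantor κ) : Prop := ∀ γ ∈ X, η γ = ξ γ

theorem smooth_eqOnRel (hκ : κ.IsRegular) (X : Set (Below κ)) : Smooth (eqOnRel X) := by
  classical
  refine ⟨fun η γ => if γ ∈ X then η γ else false, continuous_of_local hκ fun γ => ?_,
    fun η ξ => ⟨fun h => ?_, fun h γ hγ => ?_⟩⟩
  · obtain ⟨b, hb⟩ := exists_gt_below hκ γ
    exact ⟨b, fun η ξ h => by simp only [h γ hb]⟩
  · funext γ
    by_cases hγ : γ ∈ X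
    · simp only [if_pos hγ, h γ hγ]
    · simp only [if_neg hγ]
  · have := congrFun h γ
    simpa [hγ] using this

theorem E0_iff_xor {η ξ : Cantor κ} : E0 κ η ξ ↔ ∃ b, ∀ γ, b < γ → xorCantor η ξ γ = false := by
  rw [E0_iff]
  refine exists_congr fun b => forall_congr' fun γ => imp_congr_right fun _ => ?_
  rw [xorCantor]
  cases η γ <;> cases ξ γ <;> decide

end Relations

/-! ### Cub sets, stationary sets and reindexing along a cub set. -/

section Cub

variable {κ μ : Cardinal.{u}}

/-- Every `γ` has a next element in an unbounded set. -/
theorem exists_next {C : Set (Below κ)} (hC : ∀ β : Below κ, ∃ γ ∈ C, β < γ) :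
    ∃ n : Below κ → Below κ, ∀ γ, n γ ∈ C ∧ γ < n γ ∧ ∀ c ∈ C, γ < c → n γ ≤ c := by
  have h : ∀ γ, ∃ c, c ∈ C ∧ γ < c ∧ ∀ c' ∈ C, γ < c' → c ≤ c' := fun γ => by
    have hne : {c | c ∈ C ∧ γ < c}.Nonempty := hC γ
    exact ⟨WellFounded.min wellFounded_lt _ hne, (WellFounded.min_mem _ _ hne).1,
      (WellFounded.min_mem _ _ hne).2, fun c' h1 h2 =>
      WellFounded.min_le wellFounded_lt (s := {c | c ∈ C ∧ γ < c}) ⟨h1, h2⟩⟩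
  choose n hn using h
  exact ⟨n, hn⟩

theorem IsSeqClosedOf.mem_of_limit {C : Set (Below κ)} (hC : IsSeqClosedOf κ μ C) {α : Below κ}
    (hα : α ∈ cofSet κ μ) (h : ∀ β < α, ∃ c ∈ C, β < c ∧ c < α) : α ∈ C := by
  obtain ⟨s, h1, h2, -, h3⟩ := exists_strictMono_isLUB hα h
  exact hC s h1 h2 α h3

theorem IsCubOf.inter (hκ : κ.IsRegular) (hμ : μ.IsRegular) (hμκ : μ < κ) {C C' : Set (Below κ)}
    (hC : IsCubOf κ μ C) (hC' : IsCubOf κ μ C') : IsCubOf κ μ (C ∩ C') := by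
  refine ⟨fun s h1 h2 γ h3 => ⟨hC.1 s h1 (fun i => (h2 i).1) γ h3,
    hC'.1 s h1 (fun i => (h2 i).2) γ h3⟩, fun β => ?_⟩
  obtain ⟨n, hn⟩ := exists_next hC.2
  obtain ⟨n', hn'⟩ := exists_next hC'.2
  -- A point closed under both next-element functions is a limit of both sets.
  obtain ⟨δ, hδ, hβ, hcl⟩ := exists_mem_cofSet_closed hκ hμ hμκ (fun γ => max (n γ) (n' γ)) β
  refine ⟨δ, ⟨hC.1.mem_of_limit hδ fun b hb => ⟨n b, (hn b).1, (hn b).2.1, ?_⟩,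
    hC'.1.mem_of_limit hδ fun b hb => ⟨n' b, (hn' b).1, (hn' b).2.1, ?_⟩⟩, hβ⟩
  · exact (le_max_left _ _).trans_lt (hcl b hb)
  · exact (le_max_right _ _).trans_lt (hcl b hb)

theorem not_isStationaryOf_iff {A : Set (Below κ)} :
    ¬ IsStationaryOf κ μ A ↔ ∃ C, IsCubOf κ μ C ∧ ∀ α ∈ C, α ∉ A := by
  simp only [IsStationaryOf, not_forall, Set.Nonempty, mem_inter_iff, not_exists, not_and',
    exists_prop]

theorem isCubOf_cofSet (hκ : κ.IsRegular) (hμ : μ.IsRegular) (hμκ : μ < κ) :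
    IsCubOf κ μ (cofSet κ μ) := by
  refine ⟨fun s hs _ γ hγ => ?_, fun β => ?_⟩
  · have hlim := Cardinal.isSuccLimit_ord hμ.aleph0_le
    have hlt : ∀ i, s i < γ := fun i =>
      (hs (a := i) (b := ⟨Order.succ i.1, hlim.succ_lt i.2⟩) (Order.lt_succ i.1)).trans_le
        (hγ.1 ⟨_, rfl⟩)
    let g : Set.Iio μ.ord → Set.Iio γ.1 := fun i => ⟨(s i).1, hlt i⟩
    have hg : StrictMono g := fun i j hij => hs hij
    have hg' : IsCofinal (Set.range g) := fun b => by
      obtain ⟨_, ⟨i, rfl⟩, hbi⟩ := (lt_isLUB_iff hγ).1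
        (show (⟨b.1, mem_Iio_ord_of_lt b.2⟩ : Below κ) < γ from b.2)
      exact ⟨g i, ⟨_, rfl⟩, hbi.le⟩
    have := Order.cof_congr_of_strictMono hg hg'
    rw [Ordinal.cof_Iio, Ordinal.cof_Iio, ← Ordinal.lift_cof, ← Ordinal.lift_cof,
      Cardinal.lift_inj, hμ.cof_ord] at this
    exact this.symm
  · obtain ⟨δ, hδ, hβ, -⟩ := exists_mem_cofSet_closed hκ hμ hμκ id β
    exact ⟨δ, hδ, hβ⟩

theorem isStationaryOf_inter_cofSet (hκ : κ.IsRegular) (hμ : μ.IsRegular) (hμκ : μ < κ)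
    {A : Set (Below κ)} (hA : IsStationaryOf κ μ A) : IsStationaryOf κ μ (A ∩ cofSet κ μ) := by
  intro C hC
  obtain ⟨α, h1, h2, h3⟩ := hA _ ((isCubOf_cofSet hκ hμ hμκ).inter hκ hμ hμκ hC)
  exact ⟨α, ⟨h1, h2⟩, h3⟩

/-- `d` is constant from some point on. -/
def UltimatelyConst (d : Cantor κ) : Prop := ∃ b, ∃ k : Bool, ∀ γ, b < γ → d γ = k

/-- Both values occur cofinally. If `g` bounds the next occurrence of each, then a point closed
under `g` sees both values arbitrarily close below it. -/
theorem exists_switch {d : Cantor κ} (hd : ¬ UltimatelyConst d) :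
    ∃ g : Below κ → Below κ, ∀ δ, (∀ γ < δ, g γ < δ) → ¬ EventuallyConstBelow d δ := by
  have h : ∀ (k : Bool) (b : Below κ), ∃ γ, b < γ ∧ d γ = k := by
    intro k b
    by_contra! hcon
    exact hd ⟨b, !k, fun γ hγ => Bool.eq_not_of_ne (hcon γ hγ)⟩
  choose g hg hgk using h
  refine ⟨fun γ => max (g true γ) (g false γ), fun δ hδ ⟨β, hβ, k, hk⟩ => ?_⟩
  have h1 := hδ β hβ
  have ht := hk _ (hg true β) ((le_max_left _ _).trans_lt h1)
  have hf := hk _ (hg false β) ((le_max_right _ _).trans_lt h1)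
  rw [hgk] at ht hf
  exact absurd (ht.trans hf.symm) (by decide)

theorem isCubOf_closed (hκ : κ.IsRegular) (hμ : μ.IsRegular) (hμκ : μ < κ)
    (g : Below κ → Below κ) : IsCubOf κ μ {δ | ∀ γ < δ, g γ < δ} := by
  refine ⟨fun s hs h2 δ hδ γ hγ => ?_, fun β => ?_⟩
  · obtain ⟨_, ⟨i, rfl⟩, hi⟩ := (lt_isLUB_iff hδ).1 hγ
    exact (h2 i γ hi).trans_le (hδ.1 ⟨i, rfl⟩)
  · obtain ⟨δ, -, hβ, hcl⟩ := exists_mem_cofSet_closed hκ hμ hμκ g β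
    exact ⟨δ, hcl, hβ⟩

theorem ultimatelyConst_of_stationary (hκ : κ.IsRegular) (hμ : μ.IsRegular) (hμκ : μ < κ)
    {Z : Set (Below κ)} (hZ : IsStationaryOf κ μ Z) {d : Cantor κ}
    (hd : ∀ α ∈ Z, EventuallyConstBelow d α) : UltimatelyConst d := by
  by_contra hcon
  obtain ⟨g, hg⟩ := exists_switch hcon
  obtain ⟨α, hα, hcl⟩ := hZ _ (isCubOf_closed hκ hμ hμκ g)
  exact hg α hcl (hd α hα)

/-- Otherwise the points of cofinality `μ` closed under the switching function are unbounded. Some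
point of cofinality `μ` is a limit of them, and there scatteredness fails. No stationary set is
involved. -/
theorem ultimatelyConst_of_scattered (hκ : κ.IsRegular) (hμ : μ.IsRegular) (hμκ : μ < κ)
    {η ξ : Cantor κ} (h : ScatteredRel κ μ η ξ) : UltimatelyConst (xorCantor η ξ) := by
  by_contra hcon
  obtain ⟨g, hg⟩ := exists_switch hcon
  have h1 := fun β => exists_mem_cofSet_closed hκ hμ hμκ g β
  choose p hp hp1 hp2 using h1
  obtain ⟨b⟩ := nonempty_below hκ
  obtain ⟨α, hα, -, hcl⟩ := exists_mem_cofSet_closed hκ hμ hμκ p b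
  obtain ⟨β, hβ, h2⟩ := h α hα
  exact hg _ (hp2 β) (h2 _ (hp β) (hp1 β) (hcl β hβ))

/-- If `C` is cofinal in `α`, then `α ∈ C` and `n` maps a final part of `α` into itself, so
constancy is inherited. Otherwise `n` is constant on a final part of `α`. -/
theorem eventuallyConstBelow_comp_next {C : Set (Below κ)} (hC : IsCubOf κ μ C)
    {n : Below κ → Below κ} (hn : ∀ γ, n γ ∈ C ∧ γ < n γ ∧ ∀ c ∈ C, γ < c → n γ ≤ c)
    {d : Cantor κ} {α : Below κ} (hα : α ∈ cofSet κ μ)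
    (hd : α ∈ C → EventuallyConstBelow d α) :
    EventuallyConstBelow (reindex n d) α := by
  by_cases h : ∀ β < α, ∃ c ∈ C, β < c ∧ c < α
  · obtain ⟨β, hβ, k, hk⟩ := hd (hC.1.mem_of_limit hα h)
    refine ⟨β, hβ, k, fun γ h1 h2 => hk _ (h1.trans (hn γ).2.1) ?_⟩
    obtain ⟨c, hc, h3, h4⟩ := h γ h2
    exact ((hn γ).2.2 c hc h3).trans_lt h4
  · push Not at h
    obtain ⟨β, hβ, h1⟩ := h
    refine ⟨β, hβ, d (n β), fun γ h2 h3 => congrArg d (le_antisymm ?_ ?_)⟩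
    · refine (hn γ).2.2 _ (hn β).1 ?_
      exact h3.trans_le (h1 _ (hn β).1 (hn β).2.1)
    · exact (hn β).2.2 _ (hn γ).1 (h2.trans (hn γ).2.1)

theorem continuous_reindex (hκ : κ.IsRegular) (h : Below κ → Below κ) :
    Continuous (reindex h) :=
  continuous_of_local hκ fun γ => by
    obtain ⟨b, hb⟩ := exists_gt_below hκ (h γ)
    exact ⟨b, fun _ _ hag => hag (h γ) hb⟩

/-- A cofinal sample determines the final value of an ultimately constant sequence. -/
theorem E0_comp_next_iff {η ξ : Cantor κ} {n : Below κ → Below κ} (hn : ∀ γ, γ < n γ)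
    (hu : UltimatelyConst (xorCantor η ξ)) :
    E0 κ (reindex n η) (reindex n ξ) ↔ E0 κ η ξ := by
  rw [E0_iff_xor, E0_iff_xor]
  constructor
  · rintro ⟨b, hb⟩
    obtain ⟨b', k, hk⟩ := hu
    refine ⟨b', fun γ hγ => ?_⟩
    have h1 := hb (n (max b b')) ((le_max_left _ _).trans_lt (hn _))
    have h2 : xorCantor η ξ (n (n (max b b'))) = k :=
      hk _ (((le_max_right b b').trans_lt (hn _)).trans (hn _))
    rw [hk γ hγ, ← h2]
    exact h1
  · rintro ⟨b, hb⟩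
    exact ⟨b, fun γ hγ => hb _ (hγ.trans (hn γ))⟩

/-- If `Z` is not stationary, then `E₀` is reducible to `E_Z`. -/
theorem E0_reducible_ES (hκ : κ.IsRegular) {Z : Set (Below κ)} (hZ : Z ⊆ cofSet κ μ)
    (hns : ¬ IsStationaryOf κ μ Z) : BorelReducible κ (E0 κ) (ES κ Z) := by
  classical
  obtain ⟨C, hC, hCZ⟩ := not_isStationaryOf_iff.1 hns
  obtain ⟨n, hn⟩ := exists_next hC.2
  have hmono : ∀ γ γ', γ ≤ γ' → n γ ≤ n γ' := fun γ γ' h =>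
    (hn γ).2.2 _ (hn γ').1 (h.trans_lt (hn γ').2.1)
  have hcard : Cardinal.mk (Set.range n) = Cardinal.mk (Below κ) := by
    refine le_antisymm (Cardinal.mk_set_le _) ?_
    rw [mk_below]
    by_contra! hlt
    obtain ⟨b, hb⟩ := bddAbove_of_mk_lt hκ hlt
    exact absurd (hb ⟨b, rfl⟩) (hn b).2.1.not_ge
  obtain ⟨e⟩ := Cardinal.eq.1 hcard
  -- Via `e`, each bit of `η` is copied to the whole block of those `γ` that share the next point `n
  -- γ`. The differences of images are then constant near every point outside `C`, in particular on
  -- `Z`.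
  let g : Below κ → Below κ := fun c => if h : c ∈ Set.range n then e ⟨c, h⟩ else c
  have hg : ∀ x : Set.range n, g x.1 = e x := fun x => dif_pos x.2
  refine ⟨reindex fun γ => g (n γ), IsBorelFun.of_continuous (continuous_reindex hκ _),
    fun η ξ => ?_⟩
  have hstar : EStar κ Z (reindex (fun γ => g (n γ)) η) (reindex (fun γ => g (n γ)) ξ) := fun α hα =>
    eventuallyConstBelow_comp_next hC hn (d := reindex g (xorCantor η ξ)) (hZ hα)
      fun h => absurd hα (hCZ α h)
  refine Iff.trans ?_ (and_iff_right hstar).symm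
  constructor
  -- The bijection `e` need not respect the order. Boundedness is therefore carried across as having
  -- cardinality less than `κ`, in both directions.
  · intro h
    have h1 := mk_lt_of_bddAbove hκ h
    have h2 : Cardinal.mk {c : Set.range n | η (e c) ≠ ξ (e c)} < Cardinal.lift.{u + 1} κ := by
      refine lt_of_le_of_lt ?_ h1
      exact Cardinal.mk_le_of_injective (f := fun c => ⟨e c.1, c.2⟩)
        fun c c' hc => Subtype.ext (e.injective (congrArg Subtype.val hc))
    obtain ⟨b, hb⟩ := exists_forall_lt hκ (fun c : {c : Set.range n | η (e c) ≠ ξ (e c)} => c.1.1) h2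
    refine ⟨b, fun γ hγ => ?_⟩
    have hγ' : η (e ⟨n γ, γ, rfl⟩) ≠ ξ (e ⟨n γ, γ, rfl⟩) := by
      rw [← hg]
      exact hγ
    exact (hn γ).2.1.le.trans (hb ⟨⟨n γ, γ, rfl⟩, hγ'⟩).le
  · rintro ⟨b, hb⟩
    apply bddAbove_of_mk_lt hκ
    refine lt_of_le_of_lt ?_ (mk_lt_of_bddAbove hκ (bddAbove_Iic (a := n b)))
    refine Cardinal.mk_le_of_injective (f := fun γ => ⟨(e.symm γ.1).1, ?_⟩) ?_
    · obtain ⟨γ', hγ'⟩ := (e.symm γ.1).2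
      rw [← hγ']
      refine hmono _ _ (hb ?_)
      have h3 : g (n γ') = γ.1 := by
        rw [hγ', hg, Equiv.apply_symm_apply]
      change η (g (n γ')) ≠ ξ (g (n γ'))
      rw [h3]
      exact γ.2
    · intro γ γ' h
      have h1 := congrArg Subtype.val h
      exact Subtype.ext (e.symm.injective (Subtype.ext h1))

end Cub

/-! ### Forcing the difference of the images to oscillate. -/

section Alternation

variable {κ μ : Cardinal.{u}}

/-- `d` is eventually constant at the points of `T` up to `δ`. -/
def ConstUpTo (T : Set (Below κ)) (δ : Below κ) (d : Cantor κ) : Prop :=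
  ∀ α ∈ T, α ≤ δ → EventuallyConstBelow d α

theorem ConstUpTo.congr {T : Set (Below κ)} {δ : Below κ} {d d' : Cantor κ}
    (h : ConstUpTo T δ d) (hd : ∀ γ < δ, d' γ = d γ) : ConstUpTo T δ d' := fun α hα hle => by
  have h1 := h α hα hle
  obtain ⟨β, hβ, -⟩ := id h1
  exact h1.congr hβ fun γ _ h2 => hd γ (h2.trans_le hle)

/-- A constant part may be appended. -/
theorem ConstUpTo.of_const {T : Set (Below κ)} {δ δ' : Below κ} {d : Cantor κ}
    (h : ConstUpTo T δ d) {k : Bool} (hk : ∀ γ, δ ≤ γ → γ < δ' → d γ = k) :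
    ConstUpTo T δ' d := fun α hα hle => by
  rcases le_or_gt α δ with h1 | h1
  · exact h α hα h1
  · exact ⟨δ, h1, k, fun γ h2 h3 => hk γ h2.le (h3.trans_le hle)⟩

/-- Continuity of `f` on the set `D`. -/
def ContinuousOnSet (D : Set (Cantor κ)) (f : Cantor κ → Cantor κ) : Prop :=
  ∀ η ∈ D, ∀ θ, ∃ δ, ∀ ξ ∈ D, (∀ γ < δ, ξ γ = η γ) → ∀ γ < θ, f ξ γ = f η γ

variable {T : Set (Below κ)} {R P : Cantor κ → Cantor κ → Prop} {f g : Cantor κ → Cantor κ}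
  {D : Set (Cantor κ)}

/-- The part `P` of a target relation is respected by members of `D` that are only locally, at the
points of `T`, related. -/
theorem smooth_part_of_reduction (hκ : κ.IsRegular) (hP : Smooth P)
    (h1 : ∀ η ξ, EStar κ T η ξ → E0 κ η ξ → R η ξ) (hR : ∀ η ξ, R η ξ → P (f η) (f ξ))
    (hD : Comeager D) (hf : ContinuousOnSet D f) {x y : Cantor κ} (hx : x ∈ D) (hy : y ∈ D)
    (hxy : EStar κ T x y) : P (f x) (f y) := by
  by_contra hn
  obtain ⟨θ, hθ⟩ := hP.exists_not hκ hn
  obtain ⟨δ, hδ⟩ := hf x hx θ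
  obtain ⟨δ', hδ'⟩ := hf y hy θ
  obtain ⟨x', hx', y', hy', hxx, hyy, hk⟩ := hD.exists_pair hκ (max δ δ') x y false
  refine hθ _ _ (hδ x' hx' fun γ hγ => hxx γ (lt_max_of_lt_left hγ))
    (hδ' y' hy' fun γ hγ => hyy γ (lt_max_of_lt_right hγ)) (hR _ _ (h1 _ _ ?_ ?_))
  · have h2 : ConstUpTo T (max δ δ') (xorCantor x' y') :=
      ConstUpTo.congr (d := xorCantor x y) (fun α hα _ => hxy α hα) fun γ hγ => by
        rw [xorCantor, xorCantor, hxx γ hγ, hyy γ hγ]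
    exact fun α hα => (h2.of_const (δ' := α) fun γ h3 _ => hk γ h3) α hα le_rfl
  · exact E0_iff_xor.2 ⟨max δ δ', fun γ hγ => hk γ hγ.le⟩

/-- Two initial segments can be extended in such a way that the difference of the images takes both
values, while the difference of the segments remains eventually constant at the points of `T`. -/
theorem exists_alternation (hκ : κ.IsRegular) (hP : Smooth P)
    (h1 : ∀ η ξ, EStar κ T η ξ → E0 κ η ξ → R η ξ) (h2 : ∀ η ξ, R η ξ → E0 κ η ξ)
    (hR : ∀ η ξ, R η ξ ↔ P (f η) (f ξ) ∧ E0 κ (g (f η)) (g (f ξ)))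
    (hD : Comeager D) (hf : ContinuousOnSet D f) (hgf : ContinuousOnSet D (g ∘ f))
    (δ a : Below κ) (x y : Cantor κ) (hxy : ConstUpTo T δ (xorCantor x y)) :
    ∃ (δ' : Below κ) (x' y' : Cantor κ), δ < δ' ∧ a < δ' ∧ (∀ γ < δ, x' γ = x γ) ∧
      (∀ γ < δ, y' γ = y γ) ∧ ConstUpTo T δ' (xorCantor x' y') ∧
      ∀ η ∈ D, ∀ ξ ∈ D, (∀ γ < δ', η γ = x' γ) → (∀ γ < δ', ξ γ = y' γ) →
        ∀ k, ∃ γ, δ < γ ∧ γ < δ' ∧ xorCantor (g (f η)) (g (f ξ)) γ = k := by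
  -- First continuation, with difference 0: the pair is `R`-related, so the images agree at some
  -- `γ₀` beyond `δ`.
  obtain ⟨x₁, hx₁, y₁, hy₁, hxx₁, hyy₁, hk₁⟩ := hD.exists_pair hκ δ x y false
  have hc₁ : ConstUpTo T δ (xorCantor x₁ y₁) := hxy.congr fun γ hγ => by
    rw [xorCantor, xorCantor, hxx₁ γ hγ, hyy₁ γ hγ]
  have hR₁ : R x₁ y₁ := h1 _ _ (fun α hα => (hc₁.of_const (δ' := α) fun γ h3 _ => hk₁ γ h3) α hα
    le_rfl) (E0_iff_xor.2 ⟨δ, fun γ hγ => hk₁ γ hγ.le⟩)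
  obtain ⟨b, hb⟩ := E0_iff_xor.1 ((hR _ _).1 hR₁).2
  obtain ⟨γ₀, hγ₀⟩ := exists_gt_below hκ (max b δ)
  obtain ⟨c₀, hc₀⟩ := exists_gt_below hκ γ₀
  have he₀ := hb γ₀ ((le_max_left _ _).trans_lt hγ₀)
  obtain ⟨δx, hδx⟩ := hgf x₁ hx₁ c₀
  obtain ⟨δy, hδy⟩ := hgf y₁ hy₁ c₀
  obtain ⟨δ₁, hδ₁⟩ : ∃ δ₁, δ₁ = max δ (max δx δy) := ⟨_, rfl⟩
  have hδδ₁ : δ ≤ δ₁ := hδ₁ ▸ le_max_left _ _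
  have hδx₁ : δx ≤ δ₁ := hδ₁ ▸ (le_max_left _ _).trans (le_max_right _ _)
  have hδy₁ : δy ≤ δ₁ := hδ₁ ▸ (le_max_right _ _).trans (le_max_right _ _)
  -- Second continuation, with difference 1 from `δ₁` on. The length `δ₁` exceeds the moduli at
  -- `γ₀`, so what was gained there is kept.
  obtain ⟨x₂, hx₂, y₂, hy₂, hxx₂, hyy₂, hk₂⟩ := hD.exists_pair hκ δ₁ x₁ y₁ true
  have hc₂ : ConstUpTo T δ₁ (xorCantor x₂ y₂) :=
    (hc₁.of_const (δ' := δ₁) fun γ h3 _ => hk₁ γ h3).congr fun γ hγ => by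
      rw [xorCantor, xorCantor, hxx₂ γ hγ, hyy₂ γ hγ]
  have hc₂' : ∀ δ', ConstUpTo T δ' (xorCantor x₂ y₂) := fun δ' =>
    hc₂.of_const fun γ h3 _ => hk₂ γ h3
  have hP₂ : P (f x₂) (f y₂) := smooth_part_of_reduction hκ hP h1 (fun η ξ h => ((hR η ξ).1 h).1)
    hD hf hx₂ hy₂ fun α hα => hc₂' α α hα le_rfl
  -- The pair is not `E₀`-equivalent, hence not `R`-related. As the smooth part holds for the
  -- images, it must be `E₀` that fails for them.
  have hn₂ : ¬ E0 κ (g (f x₂)) (g (f y₂)) := fun hE => by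
    obtain ⟨b', hb'⟩ := E0_iff_xor.1 (h2 _ _ ((hR _ _).2 ⟨hP₂, hE⟩))
    obtain ⟨c, hc⟩ := exists_gt_below hκ (max b' δ₁)
    have h3 := hb' c ((le_max_left _ _).trans_lt hc)
    have h4 : xorCantor x₂ y₂ c = true := hk₂ c ((le_max_right _ _).trans hc.le)
    rw [h3] at h4
    exact absurd h4 (by decide)
  obtain ⟨γ₁, hγ₁, he₁⟩ : ∃ γ₁, δ < γ₁ ∧ xorCantor (g (f x₂)) (g (f y₂)) γ₁ = true := by
    by_contra! hcon
    exact hn₂ (E0_iff_xor.2 ⟨δ, fun γ hγ => by simpa using hcon γ hγ⟩)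
  obtain ⟨c₁, hc₁⟩ := exists_gt_below hκ γ₁
  obtain ⟨εx, hεx⟩ := hgf x₂ hx₂ c₁
  obtain ⟨εy, hεy⟩ := hgf y₂ hy₂ c₁
  obtain ⟨δ', hδ'⟩ := exists_gt_below hκ (max (max (max δ₁ c₀) (max c₁ a)) (max εx εy))
  simp only [max_lt_iff] at hδ'
  obtain ⟨⟨⟨hl₁, hl₂⟩, hl₃, hl₄⟩, hl₅, hl₆⟩ := hδ'
  refine ⟨δ', x₂, y₂, hδδ₁.trans_lt hl₁, hl₄,
    fun γ hγ => (hxx₂ γ (hγ.trans_le hδδ₁)).trans (hxx₁ γ hγ),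
    fun γ hγ => (hyy₂ γ (hγ.trans_le hδδ₁)).trans (hyy₁ γ hγ), hc₂' δ', ?_⟩
  intro η hη ξ hξ hηx hξy k
  cases k
  · refine ⟨γ₀, (le_max_right _ _).trans_lt hγ₀, hc₀.trans hl₂, ?_⟩
    rw [← he₀, xorCantor, xorCantor]
    have e1 := hδx η hη (fun γ hγ => (hηx γ ((hγ.trans_le hδx₁).trans hl₁)).trans
      (hxx₂ γ (hγ.trans_le hδx₁))) γ₀ hc₀
    have e2 := hδy ξ hξ (fun γ hγ => (hξy γ ((hγ.trans_le hδy₁).trans hl₁)).trans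
      (hyy₂ γ (hγ.trans_le hδy₁))) γ₀ hc₀
    exact congrArg₂ Bool.xor e1 e2
  · refine ⟨γ₁, hγ₁, hc₁.trans hl₃, ?_⟩
    rw [← he₁, xorCantor, xorCantor]
    have e1 := hεx η hη (fun γ hγ => hηx γ (hγ.trans hl₅)) γ₁ hc₁
    have e2 := hεy ξ hξ (fun γ hγ => hξy γ (hγ.trans hl₆)) γ₁ hc₁
    exact congrArg₂ Bool.xor e1 e2

/-- The first component of a stage of a construction of a pair. -/
def Stage.left (c : Stage κ (Bool × Bool)) : Cantor κ := fun γ => (c.2 γ).1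

/-- The second component of a stage of a construction of a pair. -/
def Stage.right (c : Stage κ (Bool × Bool)) : Cantor κ := fun γ => (c.2 γ).2

/-- The construction of pairs along which the difference of the images alternates. It depends on a
sequence `a` of parameters, which bound the lengths from below. -/
theorem exists_run (hκ : κ.IsRegular) (hP : Smooth P)
    (h1 : ∀ η ξ, EStar κ T η ξ → E0 κ η ξ → R η ξ) (h2 : ∀ η ξ, R η ξ → E0 κ η ξ)
    (hR : ∀ η ξ, R η ξ ↔ P (f η) (f ξ) ∧ E0 κ (g (f η)) (g (f ξ)))
    (hD : Comeager D) (hf : ContinuousOnSet D f) (hgf : ContinuousOnSet D (g ∘ f)) :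
    ∃ r : (Below κ → Below κ) → Below κ → Below κ,
      (∀ a a' i, (∀ j ≤ i, a j = a' j) → r a i = r a' i) ∧
      (∀ a, StrictMono (r a)) ∧ (∀ a i, a i < r a i) ∧
      ∀ a i δ, (∀ i' < i, ∀ α ∈ T, IsLUB (r a '' Set.Iio i') α → ∃ j < i', α ≤ r a j) →
        IsLUB (r a '' Set.Iio i) δ →
        ∃ x y, E0 κ x y ∧ EStar κ (T \ {δ}) x y ∧
          ∀ i' ≤ i, (∀ j < i', ∃ k, j < k ∧ k < i') → ∀ δ', IsLUB (r a '' Set.Iio i') δ' →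
            ¬ EventuallyConstBelow (xorCantor (g (f x)) (g (f y))) δ' := by
  classical
  -- A stage whose difference is already bad is extended arbitrarily, which makes the step total.
  have hstep : ∀ (a : Below κ) (c : Stage κ (Bool × Bool)), ∃ c' : Stage κ (Bool × Bool),
      c.Extends c' ∧ a < c'.1 ∧ (ConstUpTo T c.1 (xorCantor c.left c.right) →
        ConstUpTo T c'.1 (xorCantor c'.left c'.right) ∧
        ∀ η ∈ D, ∀ ξ ∈ D, (∀ γ < c'.1, η γ = c'.left γ) → (∀ γ < c'.1, ξ γ = c'.right γ) →
          ∀ k, ∃ γ, c.1 < γ ∧ γ < c'.1 ∧ xorCantor (g (f η)) (g (f ξ)) γ = k) := by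
    intro a c
    by_cases hc : ConstUpTo T c.1 (xorCantor c.left c.right)
    · obtain ⟨δ', x', y', l1, l2, l3, l4, l5, l6⟩ :=
        exists_alternation hκ hP h1 h2 hR hD hf hgf c.1 a c.left c.right hc
      exact ⟨(δ', fun γ => (x' γ, y' γ)), ⟨l1, fun γ hγ => Prod.ext (l3 γ hγ) (l4 γ hγ)⟩, l2,
        fun _ => ⟨l5, l6⟩⟩
    · obtain ⟨δ', hδ'⟩ := exists_gt_below hκ (max c.1 a)
      exact ⟨(δ', c.2), ⟨(le_max_left _ _).trans_lt hδ', fun _ _ => rfl⟩,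
        (le_max_right _ _).trans_lt hδ', fun h => absurd h hc⟩
  choose ext hext hlt hgood using hstep
  let c₀ : Stage κ (Bool × Bool) := (⟨0, hκ.ord_pos⟩, fun _ => (false, false))
  have hext' : ∀ (a : Below κ → Below κ) i c, Stage.Extends c (ext (a i) c) :=
    fun a i c => hext _ _
  let s : (Below κ → Below κ) → Below κ → Stage κ (Bool × Bool) := fun a =>
    runStage c₀ fun i => ext (a i)
  let p : (Below κ → Below κ) → Below κ → Stage κ (Bool × Bool) := fun a =>
    preStage c₀ fun i => ext (a i)
  have hsp : ∀ a i, s a i = ext (a i) (p a i) := fun a i => runStage_eq i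
  have hlub : ∀ a i, IsLUB ((fun j => (s a j).1) '' Set.Iio i) (p a i).1 := fun a i =>
    isLUB_preStage hκ i
  have hpag : ∀ a i j γ, j < i → γ < (s a j).1 → (p a i).2 γ = (s a j).2 γ :=
    fun a i j γ hj hγ => preStage_agree hκ (hext' a) hj hγ
  have hpx : ∀ a i j γ, j < i → γ < (s a j).1 → xorCantor (p a i).left (p a i).right γ =
      xorCantor (s a j).left (s a j).right γ := fun a i j γ hj hγ => by
    simp only [xorCantor, Stage.left, Stage.right, hpag a i j γ hj hγ]
  have hmono : ∀ a, StrictMono fun i => (s a i).1 := fun a => strictMono_runStage hκ (hext' a)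
  refine ⟨fun a i => (s a i).1, fun a a' i h => ?_, hmono, fun a i => ?_,
    fun a i δ hT hδ => ?_⟩
  · exact congrArg Prod.fst (runStage_congr i fun j hj => by rw [h j hj])
  · show a i < (s a i).1
    rw [hsp]
    exact hlt _ _
  -- Admissibility could be lost only at a point of `T` that is a proper limit of stages. `hT`
  -- excludes such limits before `i`.
  have hG : ∀ i' < i, ConstUpTo T (p a i').1 (xorCantor (p a i').left (p a i').right) ∧
      ConstUpTo T (s a i').1 (xorCantor (s a i').left (s a i').right) := by
    intro i'
    induction i' using WellFoundedLT.induction with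
    | ind i' ih =>
      intro hi'
      have hp : ConstUpTo T (p a i').1 (xorCantor (p a i').left (p a i').right) := by
        intro α hα hle
        have hj : ∃ j < i', α ≤ (s a j).1 := by
          by_contra! hcon
          have : (p a i').1 ≤ α := (hlub a i').2 (by
            rintro _ ⟨j, hj, rfl⟩
            exact (hcon j hj).le)
          have heq := le_antisymm hle this
          obtain ⟨j, hj, h3⟩ := hT i' hi' α hα (heq ▸ hlub a i')
          exact absurd h3 (hcon j hj).not_ge
        obtain ⟨j, hj, h3⟩ := hj
        have h4 : ConstUpTo T (s a j).1 (xorCantor (p a i').left (p a i').right) :=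
          (ih j hj (hj.trans hi')).2.congr fun γ hγ => hpx a i' j γ hj hγ
        exact h4 α hα h3
      refine ⟨hp, ?_⟩
      rw [hsp]
      exact (hgood _ _ hp).1
  have hδp : δ = (p a i).1 := hδ.unique (hlub a i)
  -- Admissibility at `δ` itself is not claimed. Beyond `δ` the difference is 0, so `δ` is the only
  -- possible exception.
  obtain ⟨x, hx, y, hy, hxx, hyy, hk⟩ := hD.exists_pair hκ δ (p a i).left (p a i).right false
  have hle : ∀ j < i, (s a j).1 ≤ δ := fun j hj => hδ.1 ⟨j, hj, rfl⟩
  have hxs : ∀ j < i, ∀ γ < (s a j).1, x γ = (s a j).left γ := fun j hj γ hγ =>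
    (hxx γ (hγ.trans_le (hle j hj))).trans (congrArg Prod.fst (hpag a i j γ hj hγ))
  have hys : ∀ j < i, ∀ γ < (s a j).1, y γ = (s a j).right γ := fun j hj γ hγ =>
    (hyy γ (hγ.trans_le (hle j hj))).trans (congrArg Prod.snd (hpag a i j γ hj hγ))
  refine ⟨x, y, E0_iff_xor.2 ⟨δ, fun γ hγ => hk γ hγ.le⟩, fun α hα => ?_, ?_⟩
  · have hne : α ≠ δ := hα.2
    rcases hne.lt_or_gt with h | h
    · obtain ⟨_, ⟨j, hj, rfl⟩, hj2⟩ := (lt_isLUB_iff hδ).1 h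
      have h4 : ConstUpTo T (s a j).1 (xorCantor x y) := (hG j hj).2.congr fun γ hγ => by
        rw [xorCantor, xorCantor, hxs j hj γ hγ, hys j hj γ hγ]
      exact h4 α hα.1 hj2.le
    · exact ⟨δ, h, false, fun γ h3 _ => hk γ h3.le⟩
  · rintro i' hi' hlim δ' hδ' ⟨β, hβ, k, hk'⟩
    obtain ⟨_, ⟨j, hj, rfl⟩, hj2⟩ := (lt_isLUB_iff hδ').1 hβ
    -- Below a limit `i'` a further stage `l` exceeds `j`. It produced both values between its two
    -- lengths, in particular the value `!k`.
    obtain ⟨l, hjl, hl⟩ := hlim j hj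
    have hli : l < i := hl.trans_le hi'
    have h5 := (hgood (a l) (p a l) (hG l hli).1).2 x hx y hy
    rw [← hsp] at h5
    obtain ⟨γ, h6, h7, h8⟩ := h5 (hxs l hli) (hys l hli) (!k)
    have h9 : (s a j).1 ≤ (p a l).1 := (hlub a l).1 ⟨j, hjl, rfl⟩
    have h10 := hk' γ ((lt_of_lt_of_le hj2 h9).trans h6) (h7.trans_le (hδ'.1 ⟨l, hl, rfl⟩))
    rw [h8] at h10
    exact absurd h10 (by cases k <;> decide)

end Alternation

/-! ### Non-reducibility. -/

section LowerBounds

variable {κ μ : Cardinal.{u}}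

theorem ContinuousOnSet.mono {D D' : Set (Cantor κ)} {f : Cantor κ → Cantor κ}
    (hf : ContinuousOnSet D f) (h : D' ⊆ D) : ContinuousOnSet D' f := fun η hη θ => by
  obtain ⟨δ, hδ⟩ := hf η (h hη) θ
  exact ⟨δ, fun ξ hξ => hδ ξ (h hξ)⟩

theorem exists_comeager_continuousOnSet (hκ : κ.IsRegular) {f g : Cantor κ → Cantor κ}
    (hf : IsBorelFun κ f) (hg : Continuous g) :
    ∃ D, Comeager D ∧ ContinuousOnSet D f ∧ ContinuousOnSet D (g ∘ f) := by
  obtain ⟨D, hD, hDf⟩ := hf.exists_comeager hκ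
  obtain ⟨D', hD', hDg⟩ := ((IsBorelFun.of_continuous hg).comp hf).exists_comeager hκ
  exact ⟨D ∩ D', hD.inter hκ hD', ContinuousOnSet.mono hDf inter_subset_left,
    ContinuousOnSet.mono hDg inter_subset_right⟩

theorem exists_isLUB_image_Iio (hκ : κ.IsRegular) (r : Below κ → Below κ) (i : Below κ) :
    ∃ δ, IsLUB (r '' Set.Iio i) δ := by
  obtain ⟨b, hb⟩ := exists_forall_lt_Iio hκ fun j : Set.Iio i => r j.1
  refine exists_isLUB_of_bddAbove ⟨b, ?_⟩
  rintro _ ⟨j, hj, rfl⟩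
  exact (hb ⟨j, hj⟩).le

variable {R P Q : Cantor κ → Cantor κ → Prop} {g : Cantor κ → Cantor κ}

/-- If player II does not win the cub-game for the complement of `A`, then no reduction of a
relation, which does not restrict `η △ ξ` at the points of `A`, to a relation, which requires
`η △ ξ` to be eventually constant there, is possible. -/
theorem not_reducible_of_stationary (hκ : κ.IsRegular) (hμ : μ.IsRegular) (hμκ : μ < κ)
    (hGC : GCCharacterization κ μ) {A : Set (Below κ)} (hst : IsStationaryOf κ μ A)
    (h1 : ∀ η ξ, EStar κ (cofSet κ μ) η ξ → E0 κ η ξ → R η ξ) (h2 : ∀ η ξ, R η ξ → E0 κ η ξ)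
    (h3 : ∀ α ∈ A, ∀ η ξ, EStar κ (cofSet κ μ \ {α}) η ξ → E0 κ η ξ → R η ξ)
    (hP : Smooth P) (hg : Continuous g) (hPA : ∀ η ξ, P η ξ → EStar κ A (g η) (g ξ))
    (hQ : ∀ η ξ, Q η ξ ↔ P η ξ ∧ E0 κ (g η) (g ξ)) : ¬ BorelReducible κ R Q := by
  classical
  rintro ⟨f, hf, hfR⟩
  obtain ⟨D, hD, hDf, hDg⟩ := exists_comeager_continuousOnSet hκ hf hg
  have hR : ∀ η ξ, R η ξ ↔ P (f η) (f ξ) ∧ E0 κ (g (f η)) (g (f ξ)) := fun η ξ =>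
    (hfR η ξ).trans (hQ _ _)
  obtain ⟨r, hcausal, hmono, hlt, hrun⟩ := exists_run hκ hP h1 h2 hR hD hDf hDg
  have hemb : ∀ i : Below μ, i.1 < κ.ord := fun i => lt_trans i.2 (Cardinal.ord_lt_ord.2 hμκ)
  let o : Below κ := ⟨0, hκ.ord_pos⟩
  -- Player I's moves so far are padded with 0 to a sequence of parameters. By causality the reply
  -- depends only on moves already made.
  let σ : Strategy κ μ := fun i h => r (fun j =>
    if hj : ∃ hj : j.1 < μ.ord, (⟨j.1, hj⟩ : Below μ) ≤ i then h ⟨⟨j.1, hj.1⟩, hj.2⟩ else o)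
    ⟨i.1, hemb i⟩
  have hwin : σ.IsWinning Aᶜ := by
    intro a ha
    let a' : Below κ → Below κ := fun j => if hj : j.1 < μ.ord then a ⟨j.1, hj⟩ else o
    have ha' : ∀ i : Below μ, a' ⟨i.1, hemb i⟩ = a i := fun i => dif_pos i.2
    have hreply : ∀ i, σ.reply a i = r a' ⟨i.1, hemb i⟩ := by
      intro i
      refine hcausal _ _ _ fun j hj => ?_
      have hj1 : j.1 < μ.ord := lt_of_le_of_lt (show j.1 ≤ i.1 from hj) i.2
      have hj2 : ∃ hj : j.1 < μ.ord, (⟨j.1, hj⟩ : Below μ) ≤ i := ⟨hj1, hj⟩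
      have e1 : a' j = a ⟨j.1, hj1⟩ := dif_pos hj1
      rw [e1]
      exact dif_pos hj2
    refine ⟨fun i => ?_, ?_⟩
    · rw [hreply, ← ha' i]
      exact hlt _ _
    let ι : Below κ := ⟨μ.ord, Cardinal.ord_lt_ord.2 hμκ⟩
    have hι : ι ∈ cofSet κ μ := hμ.cof_ord
    obtain ⟨δ, hδ⟩ := exists_isLUB_image_Iio hκ (r a') ι
    refine ⟨δ, fun hδA => ?_, ?_, fun b hb => hδ.2 ?_⟩
    -- If `δ` were in `A`, the resulting pair would be `R`-related by `h3`, although its images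
    -- oscillate at `δ`. A proper limit of stages before `μ` has cofinality less than `μ`, so the
    -- run meets no point of `cofSet κ μ` earlier.
    · obtain ⟨x, y, hE, hs, hne⟩ := hrun a' ι δ (fun i hi α hα hlub => by
        by_contra! hcon
        have h4 := lift_cof_le_mk (α := α) (U := r a' '' Set.Iio i)
          (by rintro _ ⟨j, hj, rfl⟩; exact hcon j hj)
          (fun b hb => by
            obtain ⟨x, hx, hbx⟩ := (lt_isLUB_iff hlub).1 hb
            exact ⟨x, hx, hbx.le⟩)
        rw [show α.1.cof = μ from hα] at h4
        refine absurd (h4.trans Cardinal.mk_image_le) (not_le.2 ?_)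
        rw [mk_Iio_below, Cardinal.lift_lt]
        exact Cardinal.lt_ord.1 hi) hδ
      have h4 := ((hR x y).1 (h3 δ hδA x y hs hE)).1
      exact hne ι le_rfl (fun j hj => exists_between_of_mem_cofSet hμ hι hj) δ hδ
        (hPA _ _ h4 δ hδA)
    · rintro _ ⟨i, rfl⟩
      have h4 := hlt a' ⟨i.1, hemb i⟩
      rw [ha'] at h4
      exact h4.le.trans (hδ.1 ⟨_, i.2, rfl⟩)
    -- Each reply lies below the next move of player I, so moves and replies have the same supremum.
    · rintro _ ⟨j, hj, rfl⟩
      let i : Below μ := ⟨j.1, hj⟩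
      let k : Below μ := ⟨Order.succ j.1, (Cardinal.isSuccLimit_ord hμ.aleph0_le).succ_lt hj⟩
      have h4 := (ha k i (Order.lt_succ j.1)).2
      rw [hreply i] at h4
      exact h4.le.trans (hb ⟨k, rfl⟩)
  have hmem : Aᶜ ∈ {A : Set (Below κ) | ∃ σ : Strategy κ μ, σ.IsWinning A} := ⟨σ, hwin⟩
  rw [hGC] at hmem
  obtain ⟨C, hC, hCA⟩ := hmem
  obtain ⟨α, hα, hαC⟩ := hst C hC
  exact hCA hαC hα

/-- As `E₀` imposes no local condition, the run can take `T = ∅` and continue through limits. At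
length `μ · μ` the oscillation points of cofinality `μ` accumulate at a point of cofinality `μ`. The
cub-game plays no part. -/
theorem E0_not_reducible_of_scattered (hκ : κ.IsRegular) (hμ : μ.IsRegular) (hμκ : μ < κ)
    (hP : Smooth P) (hg : Continuous g) (hPS : ∀ η ξ, P η ξ → ScatteredRel κ μ (g η) (g ξ))
    (hQ : ∀ η ξ, Q η ξ ↔ P η ξ ∧ E0 κ (g η) (g ξ)) : ¬ BorelReducible κ (E0 κ) Q := by
  rintro ⟨f, hf, hfR⟩
  obtain ⟨D, hD, hDf, hDg⟩ := exists_comeager_continuousOnSet hκ hf hg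
  have hR : ∀ η ξ, E0 κ η ξ ↔ P (f η) (f ξ) ∧ E0 κ (g (f η)) (g (f ξ)) := fun η ξ =>
    (hfR η ξ).trans (hQ _ _)
  obtain ⟨r, -, hmono, -, hrun⟩ := exists_run (T := ∅) hκ hP (fun _ _ _ h => h)
    (fun _ _ h => h) hR hD hDf hDg
  have hμ' : μ.ord < κ.ord := Cardinal.ord_lt_ord.2 hμκ
  have hlim := Cardinal.isSuccLimit_ord hμ.aleph0_le
  have hpos : μ.ord ≠ 0 := hμ.ord_pos.ne'
  let ι : Below κ := ⟨μ.ord * μ.ord, Ordinal.isPrincipal_mul_ord hκ.aleph0_le hμ' hμ'⟩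
  have hι : ι ∈ cofSet κ μ := by
    change (μ.ord * μ.ord).cof = μ
    rw [Ordinal.cof_mul hpos hlim.isSuccPrelimit, hμ.cof_ord]
  obtain ⟨δ, hδ⟩ := exists_isLUB_image_Iio hκ (r id) ι
  have hδS := mem_cofSet_of_isLUB (hmono id) hμ hι hδ
  obtain ⟨x, y, hE, -, hne⟩ := hrun id ι δ (fun _ _ _ h => h.elim) hδ
  obtain ⟨β, hβ, hsc⟩ := hPS _ _ ((hR x y).1 hE).1 δ hδS
  obtain ⟨_, ⟨j, hj, rfl⟩, hβj⟩ := (lt_isLUB_iff hδ).1 hβ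
  have hjl : j.1 + μ.ord < μ.ord * μ.ord := by
    have hj' : j.1 < μ.ord * μ.ord := hj
    obtain ⟨q, hq, hjq⟩ := (Ordinal.lt_mul_iff_of_isSuccLimit hlim).1 hj'
    calc j.1 + μ.ord ≤ μ.ord * q + μ.ord := add_le_add_left hjq.le _
      _ = μ.ord * Order.succ q := (Ordinal.mul_succ _ _).symm
      _ < μ.ord * μ.ord := by
        have := hlim.succ_lt hq
        have := hμ.ord_pos
        gcongr
  -- The next limit of type `μ` after `j`; it is still below `μ · μ`.
  let l : Below κ := ⟨j.1 + μ.ord, hjl.trans ι.2⟩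
  have hlι : l < ι := hjl
  have hl : l ∈ cofSet κ μ := by
    change (j.1 + μ.ord).cof = μ
    rw [Ordinal.cof_add _ hpos, hμ.cof_ord]
  have hjl' : j < l := (lt_add_iff_pos_right j.1).2 hμ.ord_pos
  obtain ⟨δ', hδ'⟩ := exists_isLUB_image_Iio hκ (r id) l
  refine hne l hlι.le (fun j hj => exists_between_of_mem_cofSet hμ hl hj) δ' hδ' (hsc δ'
    (mem_cofSet_of_isLUB (hmono id) hμ hl hδ') (hβj.trans_le (hδ'.1 ⟨j, hjl', rfl⟩)) ?_)
  obtain ⟨m, hlm, hm⟩ := exists_between_of_mem_cofSet hμ hι hlι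
  refine lt_of_le_of_lt (hδ'.2 ?_) ((hmono id hlm).trans_le (hδ.1 ⟨m, hm, rfl⟩))
  rintro _ ⟨k, hk, rfl⟩
  exact (hmono id hk).le

/-- Two members of the comeager set with difference constantly 1 are locally admissible, so by
closedness of equality they have the same image. But they are not `E₀`-equivalent. -/
theorem not_reducible_idRel (hκ : κ.IsRegular) (hμ : μ.IsRegular)
    (h1 : ∀ η ξ, EStar κ (cofSet κ μ) η ξ → E0 κ η ξ → R η ξ) (h2 : ∀ η ξ, R η ξ → E0 κ η ξ) :
    ¬ BorelReducible κ R (idRel κ) := by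
  rintro ⟨f, hf, hfR⟩
  obtain ⟨D, hD, hDf, -⟩ := exists_comeager_continuousOnSet hκ hf continuous_id
  let o : Below κ := ⟨0, hκ.ord_pos⟩
  obtain ⟨x, hx, y, hy, -, -, hk⟩ := hD.exists_pair hκ o (zeroCantor κ) (zeroCantor κ) true
  have hk' : ∀ γ, xorCantor x y γ = true := fun γ => hk γ (zero_le (a := γ.1))
  have h3 := smooth_part_of_reduction hκ (smooth_id κ) h1 (fun η ξ => (hfR η ξ).1) hD hDf hx hy
    fun α hα => by
      obtain ⟨β, hβ⟩ := exists_lt_of_mem_cofSet hμ hα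
      exact ⟨β, hβ, true, fun γ _ _ => hk' γ⟩
  obtain ⟨b, hb⟩ := E0_iff_xor.1 (h2 _ _ ((hfR _ _).2 h3))
  obtain ⟨c, hc⟩ := exists_gt_below hκ b
  exact absurd ((hk' c).symm.trans (hb c hc)) (by decide)

end LowerBounds

/-! ### A difference that is bad at exactly one point. -/

section Ladder

variable {κ μ : Cardinal.{u}}

theorem succ_mod_two_ne (c : Ordinal.{u}) : (c + 1) % 2 ≠ c % 2 := by
  rcases even_or_odd_ordinal c with ⟨h, h'⟩ | ⟨h, h'⟩
  · rw [h, h', two_mul_add_one_mod_two]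
    exact one_ne_zero
  · have : c + 1 = 2 * (c / 2 + 1) := by
      conv_lhs => rw [h']
      rw [mul_add, mul_one, add_assoc, one_add_one_eq_two]
    rw [h, this, Ordinal.mul_mod]
    exact zero_ne_one

/-- There is a bounded `d` that fails to be eventually constant at exactly one point of
cofinality `μ`. -/
theorem exists_not_eventuallyConstBelow (hμ : μ.IsRegular) {α : Below κ}
    (hα : α ∈ cofSet κ μ) :
    ∃ d : Cantor κ, (∀ γ, α ≤ γ → d γ = false) ∧
      (∀ δ ∈ cofSet κ μ, δ ≠ α → EventuallyConstBelow d δ) ∧ ¬ EventuallyConstBelow d α := by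
  classical
  obtain ⟨s, hs, -, hsα, hlub⟩ := exists_strictMono_isLUB (U := Set.univ) hα fun β hβ => by
    obtain ⟨γ, h1, h2⟩ := exists_between_of_mem_cofSet hμ hα hβ
    exact ⟨γ, trivial, h1, h2⟩
  -- Ladder points of one parity are cofinal in `α`. Keeping only those makes their successors zeros
  -- of `d`, so that `d` oscillates at `α`.
  obtain ⟨t, ht⟩ : ∃ t : Ordinal.{u}, ∀ β < α, ∃ i, β < s i ∧ (s i).1 % 2 = t := by
    by_contra! hcon
    obtain ⟨β, hβ, h0⟩ := hcon 0
    obtain ⟨β', hβ', h1⟩ := hcon 1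
    obtain ⟨_, ⟨i, rfl⟩, hi⟩ := (lt_isLUB_iff hlub).1 (max_lt hβ hβ')
    rcases even_or_odd_ordinal (s i).1 with ⟨h, -⟩ | ⟨h, -⟩
    · exact h0 i ((le_max_left _ _).trans_lt hi) h
    · exact h1 i ((le_max_right _ _).trans_lt hi) h
  refine ⟨fun γ => decide (∃ i, s i = γ ∧ γ.1 % 2 = t), fun γ hγ => ?_, fun δ hδ hne => ?_, ?_⟩
  · rw [decide_eq_false_iff_not]
    rintro ⟨i, rfl, -⟩
    exact absurd (hsα i) hγ.not_gt
  · rcases hne.lt_or_gt with h | h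
    · obtain ⟨_, ⟨i, rfl⟩, hi⟩ := (lt_isLUB_iff hlub).1 h
      -- Fewer than `μ` ladder points lie below `δ`, and these are bounded below `δ` because it has
      -- cofinality `μ`.
      obtain ⟨β, hβ, hβs⟩ : ∃ β < δ, ∀ j, s j < δ → s j ≤ β := by
        by_contra! hcon
        have h4 := lift_cof_le_mk (α := δ) (U := {x | x ∈ s '' Set.Iio i ∧ x < δ})
          (fun x hx => hx.2) (fun b hb => by
            obtain ⟨j, hj, hbj⟩ := hcon b hb
            exact ⟨s j, ⟨⟨j, hs.lt_iff_lt.1 (hj.trans hi), rfl⟩, hj⟩, hbj.le⟩)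
        rw [show δ.1.cof = μ from hδ] at h4
        exact absurd (h4.trans ((Cardinal.mk_le_mk_of_subset fun x hx => hx.1).trans
          Cardinal.mk_image_le)) (mk_Iio_below_lt i).not_ge
      refine ⟨β, hβ, false, fun γ h1 h2 => ?_⟩
      rw [decide_eq_false_iff_not]
      rintro ⟨j, rfl, -⟩
      exact absurd (hβs j h2) h1.not_ge
    · refine ⟨α, h, false, fun γ h1 _ => ?_⟩
      rw [decide_eq_false_iff_not]
      rintro ⟨j, rfl, -⟩
      exact absurd (hsα j) h1.not_gt
  · rintro ⟨β, hβ, k, hk⟩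
    obtain ⟨i, hi, hit⟩ := ht β hβ
    have h1 : k = true := (hk (s i) hi (hsα i)).symm.trans (decide_eq_true ⟨i, rfl, hit⟩)
    have hlt : Order.succ (s i).1 < α.1 := (isSuccLimit_of_mem_cofSet hμ hα).succ_lt (hsα i)
    have h2 := hk ⟨Order.succ (s i).1, mem_Iio_ord_of_lt hlt⟩
      (hi.trans (Order.lt_succ (s i).1)) hlt
    obtain ⟨-, -, h3⟩ := of_decide_eq_true (h2.trans h1)
    exact succ_mod_two_ne _ (h3.trans hit.symm)

end Ladder

/-! ### The families `G` and `F`. -/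

section Main

variable {κ μ : Cardinal.{u}}

/-- A reduction that reads off the second factor along an unbounded set. -/
theorem reducible_reindex (hκ : κ.IsRegular) {P P' L L' : Cantor κ → Cantor κ → Prop}
    (hP : Smooth P) (hL : Smooth L) {j : Cantor κ → Cantor κ} (hj : Continuous j)
    (hjP : ∀ η ξ, P' (j η) (j ξ) ↔ η = ξ) {n : Below κ → Below κ} (hn : ∀ γ, γ < n γ)
    (hLL : ∀ η ξ, L η ξ → L' (reindex n η) (reindex n ξ))
    (hu : ∀ η ξ, L η ξ → UltimatelyConst (xorCantor η ξ)) :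
    BorelReducible κ (tensor hκ.aleph0_le P fun η ξ => L η ξ ∧ E0 κ η ξ)
      (tensor hκ.aleph0_le P' fun η ξ => L' η ξ ∧ E0 κ η ξ) := by
  obtain ⟨a, hac, ha⟩ := hP.tensor hκ hL
  refine reducible_tensor hκ hj hjP hac
    ((continuous_reindex hκ n).comp (continuous_oddPart hκ.aleph0_le hκ)) fun η ξ => ?_
  rw [tensor_inter_E0_iff, ← ha]
  refine and_congr_right fun h => ?_
  rw [Function.comp_apply, Function.comp_apply, E0_comp_next_iff hn (hu _ _ h.2)]
  exact (and_iff_right (hLL _ _ h.2)).symm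

theorem eStar_reindex {C X Y : Set (Below κ)} (hC : IsCubOf κ μ C) (hXY : ∀ α ∈ C, α ∉ X \ Y)
    {n : Below κ → Below κ} (hn : ∀ γ, n γ ∈ C ∧ γ < n γ ∧ ∀ c ∈ C, γ < c → n γ ≤ c)
    {η ξ : Cantor κ} (h : EStar κ (cofSet κ μ \ X) η ξ) :
    EStar κ (cofSet κ μ \ Y) (reindex n η) (reindex n ξ) := fun α hα =>
  eventuallyConstBelow_comp_next hC hn (d := xorCantor η ξ) hα.1 fun hαC =>
    h α ⟨hα.1, fun hX => hXY α hαC ⟨hX, hα.2⟩⟩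

theorem scatteredRel_reindex {C : Set (Below κ)} (hC : IsCubOf κ μ C)
    {n : Below κ → Below κ} (hn : ∀ γ, n γ ∈ C ∧ γ < n γ ∧ ∀ c ∈ C, γ < c → n γ ≤ c)
    {η ξ : Cantor κ} (h : ScatteredRel κ μ η ξ) :
    ScatteredRel κ μ (reindex n η) (reindex n ξ) := fun α hα => by
  obtain ⟨β, hβ, h1⟩ := h α hα
  exact ⟨β, hβ, fun δ hδ h2 h3 => eventuallyConstBelow_comp_next hC hn (d := xorCantor η ξ) hδ
    fun _ => h1 δ hδ h2 h3⟩

theorem eStar_mono {Z Z' : Set (Below κ)} (h : Z' ⊆ Z) {η ξ : Cantor κ} (hs : EStar κ Z η ξ) :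
    EStar κ Z' η ξ := fun α hα => hs α (h hα)

theorem scatteredRel_of_eStar (hμ : μ.IsRegular) {α : Below κ} {η ξ : Cantor κ}
    (h : EStar κ (cofSet κ μ \ {α}) η ξ) : ScatteredRel κ μ η ξ := by
  intro δ hδ
  by_cases hα : α < δ
  · exact ⟨α, hα, fun γ hγ h1 _ => h γ ⟨hγ, h1.ne'⟩⟩
  · obtain ⟨β, hβ⟩ := exists_lt_of_mem_cofSet hμ hδ
    exact ⟨β, hβ, fun γ hγ _ h2 => h γ ⟨hγ, fun he => hα (he ▸ h2)⟩⟩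

theorem tensor_idRel_merge (hκ : Cardinal.aleph0 ≤ κ) {Q : Cantor κ → Cantor κ → Prop}
    {a b c : Cantor κ} :
    tensor hκ (idRel κ) Q (mergeCantor a b) (mergeCantor a c) ↔ Q b c := by
  rw [tensor, evenPart_merge, evenPart_merge, oddPart_merge, oddPart_merge]
  exact and_iff_right rfl

theorem ES_of_subset {Z : Set (Below κ)} (hZ : Z ⊆ cofSet κ μ) (η ξ : Cantor κ)
    (h : EStar κ (cofSet κ μ) η ξ) (h' : E0 κ η ξ) : ES κ Z η ξ :=
  ⟨eStar_mono hZ h, h'⟩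

theorem ES_reducible_GRel (hκ : κ.IsRegular) (X : Set (Below κ)) :
    BorelReducible κ (ES κ (cofSet κ μ \ X)) (GRel hκ.aleph0_le μ X) :=
  right_reducible_tensor hκ fun _ => rfl

theorem isBorelEquiv_GRel (hκ : κ.IsRegular) (hpow : κ ^< κ = κ) (hμ : μ.IsRegular)
    (X : Set (Below κ)) : IsBorelEquiv κ (GRel hκ.aleph0_le μ X) :=
  isBorelEquiv_tensor hκ (smooth_id κ) (smooth_eStar hκ hpow hμ sdiff_subset)

theorem idRel_lt_GRel (hκ : κ.IsRegular) (hpow : κ ^< κ = κ) (hμ : μ.IsRegular)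
    (X : Set (Below κ)) : StrictBorelReducible κ (idRel κ) (GRel hκ.aleph0_le μ X) := by
  have hZ : cofSet κ μ \ X ⊆ cofSet κ μ := sdiff_subset
  refine ⟨idRel_reducible_tensor hκ continuous_id (fun _ _ => Iff.rfl) fun η =>
    ⟨(smooth_eStar hκ hpow hμ hZ).equivalence.refl η, (E0.equivalence hκ).refl η⟩, fun h => ?_⟩
  exact not_reducible_idRel hκ hμ (ES_of_subset hZ) (fun _ _ h => h.2)
    ((ES_reducible_GRel hκ X).trans h)

theorem GRel_reducible_E0 (hκ : κ.IsRegular) (hpow : κ ^< κ = κ) (hμ : μ.IsRegular)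
    (X : Set (Below κ)) : BorelReducible κ (GRel hκ.aleph0_le μ X) (E0 κ) :=
  reducible_E0 hκ hpow (smooth_id κ) (smooth_eStar hκ hpow hμ sdiff_subset)

theorem E0_reducible_GRel (hκ : κ.IsRegular) {X : Set (Below κ)}
    (hX : ¬ IsStationaryOf κ μ (cofSet κ μ \ X)) :
    BorelReducible κ (E0 κ) (GRel hκ.aleph0_le μ X) :=
  (E0_reducible_ES hκ sdiff_subset hX).trans (ES_reducible_GRel hκ X)

/-- The source `E₀` restricts nothing anywhere, while the target is restrictive on the stationary
set `S^κ_μ \ X`. -/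
theorem E0_not_reducible_GRel (hκ : κ.IsRegular) (hpow : κ ^< κ = κ) (hμ : μ.IsRegular)
    (hμκ : μ < κ) (hGC : GCCharacterization κ μ) {X : Set (Below κ)}
    (hX : IsStationaryOf κ μ (cofSet κ μ \ X)) :
    ¬ BorelReducible κ (E0 κ) (GRel hκ.aleph0_le μ X) :=
  not_reducible_of_stationary hκ hμ hμκ hGC hX (fun _ _ _ h => h) (fun _ _ h => h)
    (fun _ _ _ _ _ h => h) ((smooth_id κ).tensor hκ (smooth_eStar hκ hpow hμ sdiff_subset))
    (continuous_oddPart hκ.aleph0_le hκ) (fun _ _ h => h.2)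
    fun _ _ => tensor_inter_E0_iff hκ.aleph0_le

theorem GRel_reducible_of_subsetNS (hκ : κ.IsRegular) (hpow : κ ^< κ = κ) (hμ : μ.IsRegular)
    (hμκ : μ < κ) {X Y : Set (Below κ)} (h : SubsetNS κ μ X Y) :
    BorelReducible κ (GRel hκ.aleph0_le μ X) (GRel hκ.aleph0_le μ Y) := by
  obtain ⟨C, hC, hXY⟩ := not_isStationaryOf_iff.1 h
  -- Stationarity makes related differences ultimately constant, so reindexing works. Otherwise
  -- `S^κ_μ \ Y` is nonstationary too, and the reduction goes through `E₀`.
  by_cases hX : IsStationaryOf κ μ (cofSet κ μ \ X)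
  · obtain ⟨n, hn⟩ := exists_next hC.2
    exact reducible_reindex hκ (smooth_id κ) (smooth_eStar hκ hpow hμ sdiff_subset) continuous_id
      (fun _ _ => Iff.rfl) (fun γ => (hn γ).2.1) (fun _ _ => eStar_reindex hC hXY hn)
      fun _ _ hs => ultimatelyConst_of_stationary hκ hμ hμκ hX hs
  · obtain ⟨C', hC', hX'⟩ := not_isStationaryOf_iff.1 hX
    refine (GRel_reducible_E0 hκ hpow hμ X).trans (E0_reducible_GRel hκ
      (not_isStationaryOf_iff.2 ⟨C ∩ C', hC.inter hκ hμ hμκ hC', ?_⟩))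
    rintro α ⟨h1, h2⟩ ⟨h3, h4⟩
    exact hX' α h2 ⟨h3, fun h5 => hXY α h1 ⟨h5, h4⟩⟩

/-- At the points of `X \ Y` of cofinality `μ` the target restricts the difference and the source
does not, so these points cannot form a stationary set. -/
theorem subsetNS_of_GRel_reducible (hκ : κ.IsRegular) (hpow : κ ^< κ = κ) (hμ : μ.IsRegular)
    (hμκ : μ < κ) (hGC : GCCharacterization κ μ) {X Y : Set (Below κ)}
    (h : BorelReducible κ (GRel hκ.aleph0_le μ X) (GRel hκ.aleph0_le μ Y)) :
    SubsetNS κ μ X Y := fun hst => by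
  refine not_reducible_of_stationary (P := tensor hκ.aleph0_le (idRel κ)
    (EStar κ (cofSet κ μ \ Y))) hκ hμ hμκ hGC (isStationaryOf_inter_cofSet hκ hμ hμκ hst)
    (ES_of_subset (Z := cofSet κ μ \ X) sdiff_subset) (fun _ _ h => h.2) ?_
    ((smooth_id κ).tensor hκ (smooth_eStar hκ hpow hμ sdiff_subset))
    (continuous_oddPart hκ.aleph0_le hκ) ?_ (fun _ _ => tensor_inter_E0_iff hκ.aleph0_le)
    ((ES_reducible_GRel hκ X).trans h)
  · rintro α ⟨⟨hX, -⟩, -⟩ η ξ h1 h2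
    exact ⟨eStar_mono (Z := cofSet κ μ \ {α}) (fun δ hδ => ⟨hδ.1, fun he => hδ.2 (he ▸ hX)⟩) h1, h2⟩
  · exact fun η ξ h1 => eStar_mono (Z := cofSet κ μ \ Y) (fun α hα => ⟨hα.2, hα.1.2⟩) h1.2

/-- A point of `X \ Y` would be the only bad point of some bounded `d`, which is then admissible for
`X` and not for `Y`. -/
theorem subset_of_GRel_eq (hκ : κ.IsRegular) (hμ : μ.IsRegular) {X Y : Set (Below κ)}
    (hX : X ⊆ cofSet κ μ) (h : GRel hκ.aleph0_le μ X = GRel hκ.aleph0_le μ Y) : X ⊆ Y := by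
  intro α hα
  by_contra hY
  obtain ⟨d, h1, h2, h3⟩ := exists_not_eventuallyConstBelow hμ (hX hα)
  have hd : xorCantor d (zeroCantor κ) = d := funext fun _ => Bool.xor_false _
  have hG : GRel hκ.aleph0_le μ X (mergeCantor d d) (mergeCantor d (zeroCantor κ)) := by
    refine (tensor_idRel_merge _).2 ⟨fun δ hδ => ?_, E0_iff_xor.2 ⟨α, fun γ hγ => ?_⟩⟩
    · have := h2 δ hδ.1 fun he => hδ.2 (he ▸ hα)
      rwa [← hd] at this
    · rw [hd]
      exact h1 γ hγ.le
  rw [h] at hG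
  have h4 := ((tensor_idRel_merge _).1 hG).1 α ⟨hX hα, hY⟩
  change EventuallyConstBelow (xorCantor d (zeroCantor κ)) α at h4
  rw [hd] at h4
  exact h3 h4

/-- A variant of `id ⊗ E_S`, for `S = S^κ_μ \ X`, that is always strictly below `E₀`, because
`η △ ξ` is required to be scattered, and that determines `X`. -/
def FRel (hκ : Cardinal.aleph0 ≤ κ) (μ : Cardinal.{u}) (X : Set (Below κ)) :
    Cantor κ → Cantor κ → Prop :=
  tensor hκ (tensor hκ (idRel κ) (eqOnRel X)) fun η ξ =>
    (EStar κ (cofSet κ μ \ X) η ξ ∧ ScatteredRel κ μ η ξ) ∧ E0 κ η ξ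

theorem smooth_idRel_eqOnRel (hκ : κ.IsRegular) (X : Set (Below κ)) :
    Smooth (tensor hκ.aleph0_le (idRel κ) (eqOnRel X)) :=
  (smooth_id κ).tensor hκ (smooth_eqOnRel hκ X)

theorem smooth_eStar_scatteredRel (hκ : κ.IsRegular) (hpow : κ ^< κ = κ) (hμ : μ.IsRegular)
    (X : Set (Below κ)) :
    Smooth fun η ξ : Cantor κ => EStar κ (cofSet κ μ \ X) η ξ ∧ ScatteredRel κ μ η ξ :=
  (smooth_eStar hκ hpow hμ sdiff_subset).and hκ (smooth_scatteredRel hκ hpow hμ)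

theorem isBorelEquiv_FRel (hκ : κ.IsRegular) (hpow : κ ^< κ = κ) (hμ : μ.IsRegular)
    (X : Set (Below κ)) : IsBorelEquiv κ (FRel hκ.aleph0_le μ X) :=
  isBorelEquiv_tensor hκ (smooth_idRel_eqOnRel hκ X) (smooth_eStar_scatteredRel hκ hpow hμ X)

theorem continuous_mergeCantor_zero (hκ : κ.IsRegular) :
    Continuous fun η : Cantor κ => mergeCantor η (zeroCantor κ) :=
  continuous_id.mergeCantor hκ continuous_const

theorem tensor_eqOnRel_merge_zero (hκ : Cardinal.aleph0 ≤ κ) (X : Set (Below κ))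
    (η ξ : Cantor κ) : tensor hκ (idRel κ) (eqOnRel X) (mergeCantor η (zeroCantor κ))
      (mergeCantor ξ (zeroCantor κ)) ↔ η = ξ := by
  rw [tensor, evenPart_merge, evenPart_merge, oddPart_merge, oddPart_merge]
  exact and_iff_left fun _ _ => rfl

theorem eStar_scatteredRel_E0_of_eStar (hμ : μ.IsRegular) {X : Set (Below κ)} (η ξ : Cantor κ)
    (h : EStar κ (cofSet κ μ) η ξ) (h' : E0 κ η ξ) :
    (EStar κ (cofSet κ μ \ X) η ξ ∧ ScatteredRel κ μ η ξ) ∧ E0 κ η ξ := by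
  refine ⟨⟨eStar_mono sdiff_subset h, fun α hα => ?_⟩, h'⟩
  obtain ⟨β, hβ⟩ := exists_lt_of_mem_cofSet hμ hα
  exact ⟨β, hβ, fun δ hδ _ _ => h δ hδ⟩

theorem reducible_FRel (hκ : κ.IsRegular) (X : Set (Below κ)) :
    BorelReducible κ (fun η ξ => (EStar κ (cofSet κ μ \ X) η ξ ∧ ScatteredRel κ μ η ξ) ∧
      E0 κ η ξ) (FRel hκ.aleph0_le μ X) :=
  right_reducible_tensor hκ (smooth_idRel_eqOnRel hκ X).equivalence.refl

theorem idRel_lt_FRel (hκ : κ.IsRegular) (hpow : κ ^< κ = κ) (hμ : μ.IsRegular)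
    (X : Set (Below κ)) : StrictBorelReducible κ (idRel κ) (FRel hκ.aleph0_le μ X) := by
  refine ⟨idRel_reducible_tensor hκ (continuous_mergeCantor_zero hκ)
    (tensor_eqOnRel_merge_zero _ X) fun η => ⟨(smooth_eStar_scatteredRel hκ hpow hμ
      X).equivalence.refl η, (E0.equivalence hκ).refl η⟩, fun h => ?_⟩
  exact not_reducible_idRel hκ hμ (eStar_scatteredRel_E0_of_eStar hμ) (fun _ _ h => h.2)
    ((reducible_FRel hκ X).trans h)

theorem FRel_lt_E0 (hκ : κ.IsRegular) (hpow : κ ^< κ = κ) (hμ : μ.IsRegular) (hμκ : μ < κ)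
    (X : Set (Below κ)) : StrictBorelReducible κ (FRel hκ.aleph0_le μ X) (E0 κ) := by
  have hP := smooth_idRel_eqOnRel hκ X
  have hL := smooth_eStar_scatteredRel hκ hpow hμ X
  exact ⟨reducible_E0 hκ hpow hP hL, E0_not_reducible_of_scattered hκ hμ hμκ (hP.tensor hκ hL)
    (continuous_oddPart hκ.aleph0_le hκ) (fun _ _ h => h.2.2)
    fun _ _ => tensor_inter_E0_iff hκ.aleph0_le⟩

/-- Scatteredness alone makes related differences ultimately constant, so reindexing works without
distinguishing whether `S^κ_μ \ X` is stationary. -/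
theorem FRel_reducible_of_subsetNS (hκ : κ.IsRegular) (hpow : κ ^< κ = κ) (hμ : μ.IsRegular)
    (hμκ : μ < κ) {X Y : Set (Below κ)} (h : SubsetNS κ μ X Y) :
    BorelReducible κ (FRel hκ.aleph0_le μ X) (FRel hκ.aleph0_le μ Y) := by
  obtain ⟨C, hC, hXY⟩ := not_isStationaryOf_iff.1 h
  obtain ⟨n, hn⟩ := exists_next hC.2
  exact reducible_reindex hκ (smooth_idRel_eqOnRel hκ X) (smooth_eStar_scatteredRel hκ hpow hμ X)
    (continuous_mergeCantor_zero hκ) (tensor_eqOnRel_merge_zero _ Y) (fun γ => (hn γ).2.1)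
    (fun _ _ hs => ⟨eStar_reindex hC hXY hn hs.1, scatteredRel_reindex hC hn hs.2⟩)
    fun _ _ hs => ultimatelyConst_of_scattered hκ hμ hμκ hs.2

theorem subsetNS_of_FRel_reducible (hκ : κ.IsRegular) (hpow : κ ^< κ = κ) (hμ : μ.IsRegular)
    (hμκ : μ < κ) (hGC : GCCharacterization κ μ) {X Y : Set (Below κ)}
    (h : BorelReducible κ (FRel hκ.aleph0_le μ X) (FRel hκ.aleph0_le μ Y)) :
    SubsetNS κ μ X Y := fun hst => by
  refine not_reducible_of_stationary (P := tensor hκ.aleph0_le (tensor hκ.aleph0_le (idRel κ)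
    (eqOnRel Y)) fun η ξ => EStar κ (cofSet κ μ \ Y) η ξ ∧ ScatteredRel κ μ η ξ) hκ hμ hμκ hGC
    (isStationaryOf_inter_cofSet hκ hμ hμκ hst)
    (eStar_scatteredRel_E0_of_eStar (X := X) hμ) (fun _ _ h => h.2) ?_
    ((smooth_idRel_eqOnRel hκ Y).tensor hκ (smooth_eStar_scatteredRel hκ hpow hμ Y))
    (continuous_oddPart hκ.aleph0_le hκ) ?_ (fun _ _ => tensor_inter_E0_iff hκ.aleph0_le)
    ((reducible_FRel hκ X).trans h)
  · rintro α ⟨⟨hX, -⟩, -⟩ η ξ h1 h2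
    exact ⟨⟨eStar_mono (Z := cofSet κ μ \ {α}) (fun δ hδ => ⟨hδ.1, fun he => hδ.2 (he ▸ hX)⟩) h1,
      scatteredRel_of_eStar hμ h1⟩, h2⟩
  · exact fun η ξ h1 => eStar_mono (Z := cofSet κ μ \ Y) (fun α hα => ⟨hα.2, hα.1.2⟩) h1.2.1

theorem FRel_injective (hκ : κ.IsRegular) (hpow : κ ^< κ = κ) (hμ : μ.IsRegular) :
    Function.Injective (FRel hκ.aleph0_le μ) := by
  classical
  -- The factor `eqOnRel X` is tested with the indicator `e` of the single point `γ`, all other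
  -- components being 0.
  have key : ∀ (X : Set (Below κ)) γ (e : Cantor κ), (∀ β, e β = decide (β = γ)) →
      (FRel hκ.aleph0_le μ X (mergeCantor (mergeCantor (zeroCantor κ) e) (zeroCantor κ))
      (mergeCantor (mergeCantor (zeroCantor κ) (zeroCantor κ)) (zeroCantor κ)) ↔ γ ∉ X) := by
    intro X γ e he
    have h1 := (smooth_eStar_scatteredRel hκ hpow hμ X).equivalence.refl (zeroCantor κ)
    have h2 := (E0.equivalence hκ).refl (zeroCantor κ)
    rw [FRel, tensor, evenPart_merge, evenPart_merge, oddPart_merge, oddPart_merge,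
      and_iff_left (show (_ ∧ _) ∧ _ from ⟨h1, h2⟩), tensor_idRel_merge]
    constructor
    · intro h hγ
      have h3 : true = false := ((he γ).trans (decide_eq_true rfl)).symm.trans (h γ hγ)
      exact Bool.noConfusion h3
    · intro hγ β hβ
      exact (he β).trans (decide_eq_false fun h => hγ (h ▸ hβ))
  intro X Y h
  ext γ
  rw [← not_iff_not, ← key X γ _ fun _ => rfl, ← key Y γ _ fun _ => rfl, h]

end Main

theorem theorem11 (κ μ : Cardinal.{u}) (hκ : κ.IsRegular) (hpow : κ ^< κ = κ)
    (hμ : μ.IsRegular) (hμκ : μ < κ) (hGC : GCCharacterization κ μ) :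
    (∃ F : Set (Below κ) → Cantor κ → Cantor κ → Prop,
      Function.Injective F ∧
      (∀ X, IsBorelEquiv κ (F X)) ∧
      (∀ X, StrictBorelReducible κ (idRel κ) (F X) ∧ StrictBorelReducible κ (F X) (E0 κ)) ∧
      (∀ X Y, SubsetNS κ μ X Y ↔ BorelReducible κ (F X) (F Y))) ∧
    (Set.InjOn (GRel hκ.aleph0_le μ) {X | X ⊆ cofSet κ μ} ∧
      (∀ X, IsBorelEquiv κ (GRel hκ.aleph0_le μ X)) ∧
      (∀ X, StrictBorelReducible κ (idRel κ) (GRel hκ.aleph0_le μ X)) ∧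
      (∀ X, BorelReducible κ (GRel hκ.aleph0_le μ X) (E0 κ)) ∧
      (∀ X, StrictBorelReducible κ (GRel hκ.aleph0_le μ X) (E0 κ) ↔
        IsStationaryOf κ μ (cofSet κ μ \ X)) ∧
      (∀ X Y, SubsetNS κ μ X Y ↔
        BorelReducible κ (GRel hκ.aleph0_le μ X) (GRel hκ.aleph0_le μ Y))) := by
  refine ⟨⟨FRel hκ.aleph0_le μ, FRel_injective hκ hpow hμ, isBorelEquiv_FRel hκ hpow hμ,
    fun X => ⟨idRel_lt_FRel hκ hpow hμ X, FRel_lt_E0 hκ hpow hμ hμκ X⟩, fun X Y =>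
      ⟨FRel_reducible_of_subsetNS hκ hpow hμ hμκ, subsetNS_of_FRel_reducible hκ hpow hμ hμκ hGC⟩⟩,
    fun X hX Y hY h => ?_, isBorelEquiv_GRel hκ hpow hμ, idRel_lt_GRel hκ hpow hμ,
    GRel_reducible_E0 hκ hpow hμ, fun X => ⟨fun h => ?_, fun h => ?_⟩, fun X Y =>
      ⟨GRel_reducible_of_subsetNS hκ hpow hμ hμκ, subsetNS_of_GRel_reducible hκ hpow hμ hμκ hGC⟩⟩
  · exact (subset_of_GRel_eq hκ hμ hX h).antisymm (subset_of_GRel_eq hκ hμ hY h.symm)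
  · by_contra hns
    exact h.2 (E0_reducible_GRel hκ hns)
  · exact ⟨GRel_reducible_E0 hκ hpow hμ X, E0_not_reducible_GRel hκ hpow hμ hμκ hGC h⟩
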